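/- Let $N_r\ge 1$, $n\ge 1$ and $M=2^n$. For $L\ge1$ let $\mathcal S_L=\{e^{j(\pi/4+2\pi i/L)}: i=0,\dots,L-1\}$ be the $L$-PSK constellation. Let $\mathbf K\in\mathbb C^{N_r\times N_r}$ be a full-rank (hence positive definite Hermitian) covariance matrix, and let the channel $\mathbf h\sim\mathcal{CN}(\mathbf 0,\mathbf K)$, the noise $\mathbf n\sim\mathcal{CN}(\mathbf 0,\mathbf I)$ and the transmitted symbol $s$, uniform on $\mathcal S_M$, be mutually independent. For an SNR $\rho>0$ let $\mathbf y=\sqrt\rho\,\mathbf h s+\mathbf n$, let $\mathbf r=\mathscr Q_n(\mathbf y)$, where the phase quantizer $\mathscr Q_n(x)\in\arg\min_{t\in\mathcal S_{2^n}}|t-x|$ (ties broken arbitrarily) acts entrywise, let $\mathbf g=(\rho\mathbf K+\mathbf I)^{1/2}\mathbf K^{-1/2}\mathbf h$ be the asymptotic maximum-ratio combiner (AMRC), with positive semidefinite square roots, and let $\widehat s\in\arg\min_{t\in\mathcal S_M}|t-\mathbf g^{\mathrm H}\mathbf r|$ (ties broken arbitrarily) be the detected symbol. Then the average symbol error probability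 $\mathscr P(\rho)=\mathbb P(\widehat s\ne s)$ has diversity gain $G_d=N_r/2$, i.e., there is a constant $G_c>0$ with $$\mathscr P(\rho)=(G_c\,\rho)^{-N_r/2}+o\big(\rho^{-N_r/2}\big)\qquad\text{as }\rho\to\infty .$$ -/

import Mathlib

open Filter MeasureTheory ProbabilityTheory
open scoped Matrix MatrixOrder ComplexOrder

noncomputable section

namespace PhaseQuantizedSIMO

/-- The `M`-PSK constellation `{exp (j (π/4 + 2π i / M)) : i = 0, …, M - 1}`. -/
def psk (M : ℕ) : Set ℂ :=
  {z | ∃ i : ℕ, i < M ∧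
    z = Complex.exp (Complex.I * ((Real.pi / 4 + 2 * Real.pi / M * i : ℝ) : ℂ))}

/-- `Q` sends every complex number to a nearest point of the `M`-PSK constellation,
i.e. `Q x ∈ argmin_{s ∈ psk M} |s - x|` (ties are broken in an arbitrary way). -/
def IsNearestPoint (M : ℕ) (Q : ℂ → ℂ) : Prop :=
  ∀ x : ℂ, Q x ∈ psk M ∧ ∀ s ∈ psk M, ‖Q x - x‖ ≤ ‖s - x‖

/-- The circularly symmetric complex Gaussian law `CN(0, K)` on `ℂ^N` for a positive definite
covariance matrix `K`: it has density `exp (-zᴴ K⁻¹ z) / (π ^ N det K)` with respect to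
Lebesgue measure. -/
def complexGaussian {N : ℕ} (K : Matrix (Fin N) (Fin N) ℂ) : Measure (Fin N → ℂ) :=
  volume.withDensity fun z =>
    ENNReal.ofReal (Real.exp (-(star z ⬝ᵥ (K⁻¹ *ᵥ z)).re) / (Real.pi ^ N * K.det.re))

/-- The received vector `√ρ h s + w` before quantization. -/
def received {N : ℕ} (ρ : ℝ) (h : Fin N → ℂ) (s : ℂ) (w : Fin N → ℂ) : Fin N → ℂ :=
  fun i => (Real.sqrt ρ : ℂ) * h i * s + w i

/-- The AMRC combiner `g = C^{1/2} K^{-1/2} h` with `C = ρ K + I`; the square roots are the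
positive semidefinite ones. -/
def amrc {N : ℕ} (K : Matrix (Fin N) (Fin N) ℂ) (ρ : ℝ) (h : Fin N → ℂ) : Fin N → ℂ :=
  (CFC.sqrt ((ρ : ℂ) • K + 1) * (CFC.sqrt K)⁻¹) *ᵥ h

/-- The symbol estimate `D (gᴴ Q(y))` of the AMRC receiver, where the phase quantizer `Q` acts
entrywise on the received vector `y` and `D` is the minimum-distance detector. -/
def amrcEstimate {N : ℕ} (Q D : ℂ → ℂ) (K : Matrix (Fin N) (Fin N) ℂ) (ρ : ℝ)
    (h : Fin N → ℂ) (s : ℂ) (w : Fin N → ℂ) : ℂ :=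
  D (star (amrc K ρ h) ⬝ᵥ fun i => Q (received ρ h s w i))

/-- The average symbol error probability of the AMRC receiver at SNR `ρ`. -/
def sep {Ω : Type*} [MeasurableSpace Ω] (μ : Measure Ω) {N : ℕ} (Q D : ℂ → ℂ)
    (K : Matrix (Fin N) (Fin N) ℂ) (h : Ω → Fin N → ℂ) (s : Ω → ℂ) (w : Ω → Fin N → ℂ)
    (ρ : ℝ) : ℝ :=
  μ.real {ω | amrcEstimate Q D K ρ (h ω) (s ω) (w ω) ≠ s ω}

/-- An error probability `P`, as a function of the SNR `ρ`, has diversity gain `Gd`: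
`P(ρ) = (Gc ρ)^{-Gd} + o(ρ^{-Gd})` as `ρ → ∞` for some coding gain `Gc > 0`. -/
def HasDiversityGain (P : ℝ → ℝ) (Gd : ℝ) : Prop :=
  ∃ Gc : ℝ, 0 < Gc ∧ Asymptotics.IsEquivalent atTop P (fun ρ => (Gc * ρ) ^ (-Gd))

end PhaseQuantizedSIMO

end

noncomputable section

namespace PhaseQuantizedSIMO

open scoped ComplexConjugate ENNReal Topology

/-! Split the error event by the transmitted symbol `s`, the quantizer outputs `r` and the wrong
decision `t ≠ s`; there are finitely many such patterns. Up to ties, each is cut out by real-linear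
inequalities in channel and noise (`decisionTest`).

Fix a pattern. The quantizer prefers `r i` to `r i * s / t`, which gives, up to noise, a lower bound
for the component of `√ρ h i` transversal to a certain real line with unit direction `e i`. The
combiner is `√ρ h` plus an error of size `‖h‖ / √ρ` (`exists_norm_amrc_sub_le`), and the preference
of `t` over `s` bounds the sum of these same components from above. Hence every transversal
component of `h` is of order `1 / √ρ` (`abs_im_le_of_decisionTest_nonneg`): errors force each of the
`N` complex channel entries close to a real line, at the price of a factor `ρ ^ (-1/2)` per entry.

Rescaling the transversal coordinates by `√ρ` extracts the Jacobian `ρ ^ (-N/2)`. In the new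
coordinates each test reads `√ρ A + B + o(1)`, where almost surely `A` and `B` do not both vanish,
so its sign is eventually constant. The preceding bound gives a Gaussian majorant
(`exists_jointDensity_le`), and dominated convergence yields a finite limit, the same with or
without ties (`tendsto_jointLaw`). The limit is positive for the pattern in which all outputs equal
`s` and the decision is a neighbour of `s` (`limitMass_pos`). Summing over patterns gives the
leading term. -/

/-! ### PSK constellations and nearest-point decisions. -/

/-- The constellation is a coset of the group of `M`-th roots of unity. This algebraic form makes it
stable under `a * b / c`, which supplies the competitors used later. -/
theorem mem_psk_iff {M : ℕ} (hM : M ≠ 0) (z : ℂ) :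
    z ∈ psk M ↔ z ^ M = Complex.exp (Complex.I * ((Real.pi / 4 : ℝ) : ℂ)) ^ M := by
  have hne : Complex.exp (Complex.I * ((Real.pi / 4 : ℝ) : ℂ)) ≠ 0 := Complex.exp_ne_zero _
  have hMC : (M : ℂ) ≠ 0 := Nat.cast_ne_zero.2 hM
  set a := Complex.exp (Complex.I * ((Real.pi / 4 : ℝ) : ℂ)) with ha
  constructor
  · rintro ⟨i, -, rfl⟩
    rw [ha, ← Complex.exp_nat_mul, ← Complex.exp_nat_mul, Complex.exp_eq_exp_iff_exists_int]
    refine ⟨i, ?_⟩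
    push_cast
    field_simp
  · intro h
    have h1 : (z / a) ^ M = 1 := by rw [div_pow, h, div_self (pow_ne_zero _ hne)]
    have : NeZero M := ⟨hM⟩
    obtain ⟨i, hi, h2⟩ :=
      (Complex.isPrimitiveRoot_exp M hM).eq_pow_of_pow_eq_one h1
    refine ⟨i, hi, ?_⟩
    rw [eq_div_iff hne] at h2
    rw [← h2, ha, ← Complex.exp_nat_mul, ← Complex.exp_add]
    congr 1
    push_cast
    field_simp
    ring

theorem norm_of_mem_psk {M : ℕ} {z : ℂ} (hz : z ∈ psk M) : ‖z‖ = 1 := by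
  obtain ⟨i, -, rfl⟩ := hz
  rw [mul_comm]
  exact Complex.norm_exp_ofReal_mul_I _

theorem ne_zero_of_mem_psk {M : ℕ} {z : ℂ} (hz : z ∈ psk M) : z ≠ 0 := by
  rw [← norm_ne_zero_iff, norm_of_mem_psk hz]
  exact one_ne_zero

theorem finite_psk (M : ℕ) : (psk M).Finite := by
  refine ((Finset.range M).finite_toSet.image fun i : ℕ =>
    Complex.exp (Complex.I * ((Real.pi / 4 + 2 * Real.pi / M * i : ℝ) : ℂ))).subset ?_
  rintro z ⟨i, hi, rfl⟩
  exact ⟨i, by simpa using hi, rfl⟩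

theorem nonempty_psk {M : ℕ} (hM : M ≠ 0) : (psk M).Nonempty :=
  ⟨_, 0, Nat.pos_of_ne_zero hM, rfl⟩

theorem mul_div_mem_psk {M : ℕ} (hM : M ≠ 0) {a b c : ℂ} (ha : a ∈ psk M) (hb : b ∈ psk M)
    (hc : c ∈ psk M) : a * b / c ∈ psk M := by
  have hc0 := ne_zero_of_mem_psk hc
  rw [mem_psk_iff hM] at *
  rw [div_pow, mul_pow, ha, hb, hc, mul_div_assoc, div_self (pow_ne_zero _ (Complex.exp_ne_zero _)),
    mul_one]

theorem mul_mem_psk_of_pow_eq_one {M : ℕ} (hM : M ≠ 0) {a ζ : ℂ} (ha : a ∈ psk M)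
    (hζ : ζ ^ M = 1) : a * ζ ∈ psk M := by
  rw [mem_psk_iff hM] at *
  rw [mul_pow, ha, hζ, mul_one]

theorem div_pow_eq_one_of_mem_psk {M : ℕ} (hM : M ≠ 0) {a b : ℂ} (ha : a ∈ psk M)
    (hb : b ∈ psk M) : (a / b) ^ M = 1 := by
  rw [mem_psk_iff hM] at *
  rw [div_pow, ha, hb, div_self (pow_ne_zero _ (Complex.exp_ne_zero _))]

theorem norm_sub_sq_of_unit {a : ℂ} (ha : ‖a‖ = 1) (x : ℂ) :
    ‖a - x‖ ^ 2 = 1 + ‖x‖ ^ 2 - 2 * (conj x * a).re := by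
  have h := ha
  rw [← sq_eq_sq₀ (norm_nonneg _) zero_le_one, Complex.sq_norm, Complex.normSq_apply] at h
  rw [Complex.sq_norm, Complex.sq_norm, Complex.normSq_apply, Complex.normSq_apply]
  simp only [Complex.sub_re, Complex.sub_im, Complex.mul_re, Complex.conj_re, Complex.conj_im]
  linarith

/-- On the unit circle the quadratic terms cancel, so comparing distances is a real-linear condition
on `x`. -/
theorem norm_sub_le_iff_of_unit {a b : ℂ} (ha : ‖a‖ = 1) (hb : ‖b‖ = 1) (x : ℂ) :
    ‖a - x‖ ≤ ‖b - x‖ ↔ 0 ≤ (conj x * (a - b)).re := by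
  rw [← sq_le_sq₀ (norm_nonneg _) (norm_nonneg _), norm_sub_sq_of_unit ha, norm_sub_sq_of_unit hb,
    mul_sub, Complex.sub_re]
  constructor <;> intro h <;> linarith

theorem IsNearestPoint.nonneg {M : ℕ} {Q : ℂ → ℂ} (hQ : IsNearestPoint M Q) (x : ℂ) {b : ℂ}
    (hb : b ∈ psk M) : 0 ≤ (conj x * (Q x - b)).re :=
  (norm_sub_le_iff_of_unit (norm_of_mem_psk (hQ x).1) (norm_of_mem_psk hb) x).1 ((hQ x).2 b hb)

theorem IsNearestPoint.eq_of_forall_pos {M : ℕ} {Q : ℂ → ℂ} (hQ : IsNearestPoint M Q) {x a : ℂ}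
    (ha : a ∈ psk M) (h : ∀ b ∈ psk M, b ≠ a → 0 < (conj x * (a - b)).re) : Q x = a := by
  by_contra hne
  have h1 := h _ (hQ x).1 hne
  have h2 := hQ.nonneg x ha
  rw [← neg_sub, mul_neg, Complex.neg_re] at h2
  linarith

/-! ### Neighbouring roots of unity and their bisector. -/

/-- The first `M`-th root of unity, `exp (2πj / M)`. -/
def unitRoot (M : ℕ) : ℂ := Complex.exp (2 * Real.pi * Complex.I / M)

/-- The direction `exp (πj / M)`, which bisects `1` and `unitRoot M`. -/
def bisector (M : ℕ) : ℂ := Complex.exp (((Real.pi / M : ℝ) : ℂ) * Complex.I)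

theorem norm_bisector (M : ℕ) : ‖bisector M‖ = 1 := Complex.norm_exp_ofReal_mul_I _

theorem bisector_sq (M : ℕ) : bisector M * bisector M = unitRoot M := by
  rw [bisector, unitRoot, ← Complex.exp_add]
  congr 1
  push_cast
  ring

theorem unitRoot_pow {M : ℕ} (hM : M ≠ 0) : unitRoot M ^ M = 1 :=
  (Complex.isPrimitiveRoot_exp M hM).pow_eq_one

theorem conj_bisector_mul_self (M : ℕ) : conj (bisector M) * bisector M = 1 := by
  rw [mul_comm, Complex.mul_conj, Complex.normSq_eq_norm_sq, norm_bisector]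
  simp

theorem conj_bisector_mul_unitRoot (M : ℕ) :
    conj (bisector M) * unitRoot M = bisector M := by
  rw [← bisector_sq, ← mul_assoc, conj_bisector_mul_self, one_mul]

/-- The chord between two neighbouring points is orthogonal to their bisector and has length `2 sin
(π / M)`. -/
theorem one_sub_conj_unitRoot (M : ℕ) :
    1 - conj (unitRoot M) = conj (bisector M) * (2 * (Real.sin (Real.pi / M) : ℂ) * Complex.I) := by
  have h1 : conj (unitRoot M) = conj (bisector M) * conj (bisector M) := by
    rw [← bisector_sq, map_mul]
  have h2 : bisector M - conj (bisector M) = 2 * (Real.sin (Real.pi / M) : ℂ) * Complex.I := by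
    rw [Complex.sub_conj, bisector, Complex.exp_ofReal_mul_I_im]
    push_cast
    ring
  rw [h1, ← h2, mul_sub, conj_bisector_mul_self]

theorem sin_pi_div_pos {M : ℕ} (hM : 2 ≤ M) : 0 < Real.sin (Real.pi / M) := by
  have h2 : (2 : ℝ) ≤ M := by exact_mod_cast hM
  refine Real.sin_pos_of_pos_of_lt_pi (by positivity) ?_
  rw [div_lt_iff₀ (by positivity)]
  nlinarith [Real.pi_pos]

/-- The points `1` and `unitRoot M` are the strictly nearest `M`-th roots of unity to the
direction bisecting them. -/
theorem re_conj_bisector_mul_pos {M : ℕ} (hM : 2 ≤ M) {ζ : ℂ} (hζ : ζ ^ M = 1) (h1 : ζ ≠ 1)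
    (h2 : ζ ≠ unitRoot M) : 0 < (conj (bisector M) * (1 - ζ)).re := by
  have hM0 : M ≠ 0 := by omega
  have hMR : (0 : ℝ) < M := by positivity
  have : NeZero M := ⟨hM0⟩
  obtain ⟨i, hi, rfl⟩ := (Complex.isPrimitiveRoot_exp M hM0).eq_pow_of_pow_eq_one hζ
  have hi0 : i ≠ 0 := by rintro rfl; simp at h1
  have hi1 : i ≠ 1 := by rintro rfl; simp [unitRoot] at h2
  have hi2 : 2 ≤ i := by omega
  have e1 : conj (bisector M) = Complex.exp (((-(Real.pi / M) : ℝ) : ℂ) * Complex.I) := by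
    rw [bisector, ← Complex.exp_conj]
    simp
  have e2 : conj (bisector M) * Complex.exp (2 * Real.pi * Complex.I / M) ^ i =
      Complex.exp (((-(Real.pi / M) + 2 * (i * Real.pi / M) : ℝ) : ℂ) * Complex.I) := by
    rw [e1, ← Complex.exp_nat_mul, ← Complex.exp_add]
    congr 1
    push_cast
    ring
  -- The real part is `cos (π/M) - cos ((2i-1)π/M) = 2 sin (iπ/M) sin ((i-1)π/M)`, and both sines
  -- are positive for `2 ≤ i < M`.
  rw [mul_sub, mul_one, e2, e1, Complex.sub_re, Complex.exp_ofReal_mul_I_re,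
    Complex.exp_ofReal_mul_I_re, Real.cos_sub_cos]
  have hs1 : 0 < Real.sin (i * Real.pi / M) := by
    refine Real.sin_pos_of_pos_of_lt_pi (by positivity) ?_
    rw [div_lt_iff₀ hMR]
    have : (i : ℝ) < M := by exact_mod_cast hi
    nlinarith [Real.pi_pos]
  have hs2 : 0 < Real.sin ((i - 1) * Real.pi / M) := by
    have h3 : (2 : ℝ) ≤ i := by exact_mod_cast hi2
    have : (i : ℝ) < M := by exact_mod_cast hi
    refine Real.sin_pos_of_pos_of_lt_pi
      (div_pos (mul_pos (by linarith) Real.pi_pos) hMR) ?_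
    rw [div_lt_iff₀ hMR]
    nlinarith [Real.pi_pos]
  have a1 : (-(Real.pi / M) + (-(Real.pi / M) + 2 * (i * Real.pi / M))) / 2 =
      (i - 1) * Real.pi / M := by ring
  have a2 : (-(Real.pi / M) - (-(Real.pi / M) + 2 * (i * Real.pi / M))) / 2 =
      -(i * Real.pi / M) := by ring
  rw [a1, a2, Real.sin_neg]
  nlinarith [mul_pos hs1 hs2]

/-! ### High-SNR expansion of the AMRC combiner. -/

/-- The matrix `U diag(d) Uᴴ`. -/
def conjDiagonal {N : ℕ} (U : Matrix (Fin N) (Fin N) ℂ) (d : Fin N → ℝ) :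
    Matrix (Fin N) (Fin N) ℂ :=
  U * Matrix.diagonal (fun i => (d i : ℂ)) * Uᴴ

section conjDiagonal

variable {N : ℕ} {U : Matrix (Fin N) (Fin N) ℂ}

theorem conjDiagonal_mul (hU : Uᴴ * U = 1) (d d' : Fin N → ℝ) :
    conjDiagonal U d * conjDiagonal U d' = conjDiagonal U (fun i => d i * d' i) := by
  have : conjDiagonal U d * conjDiagonal U d' = U * Matrix.diagonal (fun i => (d i : ℂ)) *
      (Uᴴ * U) * Matrix.diagonal (fun i => (d' i : ℂ)) * Uᴴ := by
    simp only [conjDiagonal, Matrix.mul_assoc]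
  rw [this, hU, Matrix.mul_one, Matrix.mul_assoc U, Matrix.diagonal_mul_diagonal, conjDiagonal]
  simp

theorem conjDiagonal_one (hU : U * Uᴴ = 1) : conjDiagonal U (fun _ => 1) = 1 := by
  simp [conjDiagonal, hU]

theorem conjDiagonal_smul_add (c : ℝ) (d d' : Fin N → ℝ) :
    (c : ℂ) • conjDiagonal U d + conjDiagonal U d' = conjDiagonal U (fun i => c * d i + d' i) := by
  rw [conjDiagonal, conjDiagonal, ← Matrix.smul_mul, ← Matrix.mul_smul, ← Matrix.add_mul,
    ← Matrix.mul_add, ← Matrix.diagonal_smul, Matrix.diagonal_add, conjDiagonal]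
  simp

theorem conjDiagonal_nonneg {d : Fin N → ℝ} (hd : ∀ i, 0 ≤ d i) : 0 ≤ conjDiagonal U d := by
  rw [Matrix.nonneg_iff_posSemidef]
  refine Matrix.PosSemidef.mul_mul_conjTranspose_same (Matrix.PosSemidef.diagonal ?_) U
  intro i
  exact Complex.zero_le_real.2 (hd i)

theorem norm_entry_le_one (hU : U * Uᴴ = 1) (i j : Fin N) : ‖U i j‖ ≤ 1 :=
  entry_norm_bound_of_unitary (Matrix.mem_unitaryGroup_iff.2 hU) i j

theorem norm_conjDiagonal_mulVec_le (hU : U * Uᴴ = 1) (d : Fin N → ℝ) (x : Fin N → ℂ)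
    (i : Fin N) : ‖(conjDiagonal U d *ᵥ x) i‖ ≤ N * (∑ k, |d k|) * ‖x‖ := by
  have hentry : ∀ j, ‖conjDiagonal U d i j‖ ≤ ∑ k, |d k| := by
    intro j
    rw [conjDiagonal, Matrix.mul_apply]
    refine (norm_sum_le _ _).trans (Finset.sum_le_sum fun k _ => ?_)
    rw [Matrix.mul_diagonal, Matrix.conjTranspose_apply, norm_mul, norm_mul, norm_star,
      Complex.norm_real, Real.norm_eq_abs]
    have h1 := norm_entry_le_one hU i k
    have h2 := norm_entry_le_one hU j k
    calc ‖U i k‖ * |d k| * ‖U j k‖ ≤ 1 * |d k| * 1 := by gcongr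
      _ = |d k| := by ring
  rw [Matrix.mulVec, dotProduct]
  calc ‖∑ j, conjDiagonal U d i j * x j‖ ≤ ∑ j, ‖conjDiagonal U d i j * x j‖ := norm_sum_le _ _
    _ ≤ ∑ _j : Fin N, (∑ k, |d k|) * ‖x‖ := by
        refine Finset.sum_le_sum fun j _ => ?_
        rw [norm_mul]
        have := norm_le_pi_norm x j
        have := hentry j
        gcongr
    _ = N * (∑ k, |d k|) * ‖x‖ := by
        rw [Finset.sum_const, Finset.card_univ, Fintype.card_fin, nsmul_eq_mul, mul_assoc]

end conjDiagonal

/-- Squaring shows that `√(ρ l + 1)` exceeds `√(ρ l)` by at most `1 / √(ρ l)`; dividing by `√l`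
gives the bound. It is applied to each eigenvalue `l` of `K`. -/
theorem abs_sqrt_div_sub_sqrt_le {l ρ : ℝ} (hl : 0 < l) (hρ : 0 < ρ) :
    |√(ρ * l + 1) * (√l)⁻¹ - √ρ| ≤ l⁻¹ / √ρ := by
  have hsl := Real.sqrt_pos.2 hl
  have hsr := Real.sqrt_pos.2 hρ
  have h1 : √ρ * √l ≤ √(ρ * l + 1) := by
    rw [← Real.sqrt_mul hρ.le]
    exact Real.sqrt_le_sqrt (by linarith)
  have h2 : √(ρ * l + 1) ≤ √ρ * √l + 1 / (√ρ * √l) := by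
    refine Real.sqrt_le_iff.2 ⟨by positivity, ?_⟩
    have h3 : (√ρ * √l + 1 / (√ρ * √l)) ^ 2 = ρ * l + 2 + (1 / (√ρ * √l)) ^ 2 := by
      have h4 : √ρ * √l * (1 / (√ρ * √l)) = 1 := by field_simp
      have h5 : (√ρ * √l) ^ 2 = ρ * l := by
        rw [mul_pow, Real.sq_sqrt hρ.le, Real.sq_sqrt hl.le]
      rw [add_sq, h5, mul_assoc, h4]
      ring
    rw [h3]
    nlinarith [sq_nonneg (1 / (√ρ * √l))]
  have h6 : √(ρ * l + 1) * (√l)⁻¹ - √ρ = (√(ρ * l + 1) - √ρ * √l) * (√l)⁻¹ := by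
    field_simp
  have h7 : l⁻¹ / √ρ = 1 / (√ρ * √l) * (√l)⁻¹ := by
    rw [← Real.mul_self_sqrt hl.le]
    field_simp
    rw [Real.sqrt_sq hsl.le]
  rw [h6, h7, abs_of_nonneg (mul_nonneg (by linarith) (by positivity))]
  gcongr
  linarith

/-- At high SNR the AMRC combiner is `√ρ h` up to an error of order `1 / √ρ`. -/
theorem exists_norm_amrc_sub_le {N : ℕ} {K : Matrix (Fin N) (Fin N) ℂ} (hK : K.PosDef) :
    ∃ C : ℝ, 0 ≤ C ∧ ∀ ρ : ℝ, 0 < ρ → ∀ (x : Fin N → ℂ) (i : Fin N),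
      ‖amrc K ρ x i - (√ρ : ℂ) * x i‖ ≤ C / √ρ * ‖x‖ := by
  set l := hK.1.eigenvalues with hl
  set U : Matrix (Fin N) (Fin N) ℂ := hK.1.eigenvectorUnitary.1 with hUdef
  have hlpos : ∀ i, 0 < l i := hK.eigenvalues_pos
  have hU1 : U * Uᴴ = 1 := Matrix.mem_unitaryGroup_iff.1 hK.1.eigenvectorUnitary.2
  have hU2 : Uᴴ * U = 1 := Matrix.mem_unitaryGroup_iff'.1 hK.1.eigenvectorUnitary.2
  have hKd : K = conjDiagonal U l := by
    have := hK.1.spectral_theorem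
    rwa [Unitary.conjStarAlgAut_apply] at this
  have hS : CFC.sqrt K = conjDiagonal U (fun i => √(l i)) := by
    refine CFC.sqrt_unique ?_ (conjDiagonal_nonneg fun i => Real.sqrt_nonneg _)
    rw [conjDiagonal_mul hU2, hKd]
    congr 1
    ext i
    exact Real.mul_self_sqrt (hlpos i).le
  have hSi : (CFC.sqrt K)⁻¹ = conjDiagonal U (fun i => (√(l i))⁻¹) := by
    refine Matrix.inv_eq_right_inv ?_
    rw [hS, conjDiagonal_mul hU2, ← conjDiagonal_one hU1]
    congr 1
    ext i
    exact mul_inv_cancel₀ (Real.sqrt_pos.2 (hlpos i)).ne'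
  refine ⟨N * ∑ k, (l k)⁻¹, mul_nonneg (Nat.cast_nonneg _)
    (Finset.sum_nonneg fun k _ => (inv_pos.2 (hlpos k)).le), fun ρ hρ x i => ?_⟩
  have hB : CFC.sqrt ((ρ : ℂ) • K + 1) = conjDiagonal U (fun i => √(ρ * l i + 1)) := by
    refine CFC.sqrt_unique ?_ (conjDiagonal_nonneg fun i => Real.sqrt_nonneg _)
    rw [conjDiagonal_mul hU2, hKd, ← conjDiagonal_one hU1, conjDiagonal_smul_add]
    congr 1
    ext i
    exact Real.mul_self_sqrt (by have := hlpos i; positivity)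
  have hsub : amrc K ρ x i - (√ρ : ℂ) * x i =
      (conjDiagonal U (fun i => √(ρ * l i + 1) * (√(l i))⁻¹ - √ρ) *ᵥ x) i := by
    have h1 : conjDiagonal U (fun i => √(ρ * l i + 1) * (√(l i))⁻¹ - √ρ) =
        CFC.sqrt ((ρ : ℂ) • K + 1) * (CFC.sqrt K)⁻¹ - (√ρ : ℂ) • (1 : Matrix _ _ ℂ) := by
      rw [eq_sub_iff_add_eq, add_comm, hB, hSi, conjDiagonal_mul hU2, ← conjDiagonal_one hU1,
        conjDiagonal_smul_add]
      congr 1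
      ext i
      ring
    rw [h1, Matrix.sub_mulVec, Matrix.smul_mulVec, Matrix.one_mulVec]
    rfl
  rw [hsub]
  refine (norm_conjDiagonal_mulVec_le hU1 _ x i).trans ?_
  gcongr
  rw [mul_div_assoc, Finset.sum_div]
  gcongr with k
  exact abs_sqrt_div_sub_sqrt_le (hlpos k) hρ

theorem continuous_amrc {N : ℕ} (K : Matrix (Fin N) (Fin N) ℂ) (ρ : ℝ) :
    Continuous (amrc K ρ) :=
  continuous_const.matrix_mulVec continuous_id

/-! ### Gaussian densities and their decay. -/

/-- The density of `complexGaussian K`. -/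
def gaussianDensity {N : ℕ} (K : Matrix (Fin N) (Fin N) ℂ) (z : Fin N → ℂ) : ℝ :=
  Real.exp (-(star z ⬝ᵥ (K⁻¹ *ᵥ z)).re) / (Real.pi ^ N * K.det.re)

theorem continuous_quadForm {N : ℕ} (A : Matrix (Fin N) (Fin N) ℂ) :
    Continuous fun z : Fin N → ℂ => (star z ⬝ᵥ (A *ᵥ z)).re :=
  Complex.continuous_re.comp
    (continuous_star.dotProduct (continuous_const.matrix_mulVec continuous_id))

theorem continuous_gaussianDensity {N : ℕ} (K : Matrix (Fin N) (Fin N) ℂ) :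
    Continuous (gaussianDensity K) :=
  (Real.continuous_exp.comp (continuous_quadForm K⁻¹).neg).div_const _

theorem gaussianDensity_pos {N : ℕ} {K : Matrix (Fin N) (Fin N) ℂ} (hK : K.PosDef)
    (z : Fin N → ℂ) : 0 < gaussianDensity K z := by
  have := (Complex.pos_iff.1 hK.det_pos).1
  have := Real.pi_pos
  unfold gaussianDensity
  positivity

/-- `α` is the minimum of the form on the compact unit sphere, extended by homogeneity of degree
two. -/
theorem exists_le_quadForm {N : ℕ} {A : Matrix (Fin N) (Fin N) ℂ} (hA : A.PosDef) :
    ∃ α : ℝ, 0 < α ∧ ∀ z : Fin N → ℂ, α * ‖z‖ ^ 2 ≤ (star z ⬝ᵥ (A *ᵥ z)).re := by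
  have hpos : ∀ z : Fin N → ℂ, z ≠ 0 → 0 < (star z ⬝ᵥ (A *ᵥ z)).re := fun z hz =>
    (Complex.pos_iff.1 (hA.dotProduct_mulVec_pos hz)).1
  -- The sphere is empty only in the trivial space, `N = 0`.
  rcases (Metric.sphere (0 : Fin N → ℂ) 1).eq_empty_or_nonempty with he | hne
  · refine ⟨1, one_pos, fun z => ?_⟩
    have hz : z = 0 := by
      by_contra hz
      have : ((‖z‖⁻¹ : ℝ) • z) ∈ Metric.sphere (0 : Fin N → ℂ) 1 := by
        rw [mem_sphere_zero_iff_norm, norm_smul, norm_inv, norm_norm,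
          inv_mul_cancel₀ (norm_ne_zero_iff.2 hz)]
      rw [he] at this
      exact this
    simp [hz]
  · obtain ⟨z₀, hz₀, hmin⟩ := (isCompact_sphere (0 : Fin N → ℂ) 1).exists_isMinOn hne
      (continuous_quadForm A).continuousOn
    have hz₀' : z₀ ≠ 0 := by
      rintro rfl
      simp at hz₀
    refine ⟨_, hpos z₀ hz₀', fun z => ?_⟩
    by_cases hz : z = 0
    · simp [hz]
    have hn : ‖z‖ ≠ 0 := norm_ne_zero_iff.2 hz
    have hmem : ((‖z‖⁻¹ : ℝ) • z) ∈ Metric.sphere (0 : Fin N → ℂ) 1 := by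
      rw [mem_sphere_zero_iff_norm, norm_smul, norm_inv, norm_norm, inv_mul_cancel₀ hn]
    have h1 := isMinOn_iff.1 hmin _ hmem
    have h2 : (star ((‖z‖⁻¹ : ℝ) • z) ⬝ᵥ (A *ᵥ ((‖z‖⁻¹ : ℝ) • z))).re =
        (‖z‖ ^ 2)⁻¹ * (star z ⬝ᵥ (A *ᵥ z)).re := by
      rw [star_smul, Matrix.mulVec_smul, smul_dotProduct, dotProduct_smul, star_trivial,
        Complex.smul_re, Complex.smul_re, smul_eq_mul, smul_eq_mul, ← mul_assoc, ← mul_inv, ← sq]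
    rw [h2] at h1
    rwa [inv_mul_eq_div, le_div_iff₀ (by positivity)] at h1

theorem exists_gaussianDensity_le {N : ℕ} {K : Matrix (Fin N) (Fin N) ℂ} (hK : K.PosDef) :
    ∃ C α : ℝ, 0 < C ∧ 0 < α ∧ ∀ z, gaussianDensity K z ≤ C * Real.exp (-(α * ‖z‖ ^ 2)) := by
  obtain ⟨α, hα, h⟩ := exists_le_quadForm hK.inv
  have h1 := (Complex.pos_iff.1 hK.det_pos).1
  have h2 := Real.pi_pos
  refine ⟨(Real.pi ^ N * K.det.re)⁻¹, α, by positivity, hα, fun z => ?_⟩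
  rw [gaussianDensity, div_eq_inv_mul]
  gcongr
  exact h z

theorem lintegral_exp_neg_mul_sq_norm_ne_top {E : Type*} [NormedAddCommGroup E] [NormedSpace ℝ E]
    [FiniteDimensional ℝ E] [MeasurableSpace E] [BorelSpace E] (ν : Measure E)
    [ν.IsAddHaarMeasure] {κ : ℝ} (hκ : 0 < κ) (C : ℝ) :
    ∫⁻ x, ENNReal.ofReal (C * Real.exp (-(κ * ‖x‖ ^ 2))) ∂ν ≠ ∞ := by
  have hint : Integrable (fun x : E => Real.exp (-(κ * ‖x‖ ^ 2))) ν := by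
    -- Any exponent above the dimension makes `(1 + ‖x‖) ^ (-r)` integrable, and this power
    -- dominates the Gaussian.
    set r : ℝ := Module.finrank ℝ E + 1 with hr
    have h1 : Integrable (fun x : E => (1 + ‖x‖) ^ (-r)) ν := integrable_one_add_norm (by linarith)
    have h2 : Tendsto (fun x : ℝ => (1 + x) ^ r * Real.exp (-(κ / 2) * (1 + x))) atTop (𝓝 0) :=
      (tendsto_rpow_mul_exp_neg_mul_atTop_nhds_zero r (κ / 2) (by positivity)).comp
        (tendsto_atTop_add_const_left _ 1 tendsto_id)
    obtain ⟨D, hD⟩ : ∃ D : ℝ, ∀ x : ℝ, 0 ≤ x → (1 + x) ^ r * Real.exp (-(κ / 2) * (1 + x)) ≤ D := by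
      obtain ⟨R, hR⟩ := eventually_atTop.1 (h2.eventually (gt_mem_nhds one_pos))
      have hc : ContinuousOn (fun x : ℝ => (1 + x) ^ r * Real.exp (-(κ / 2) * (1 + x)))
          (Set.Icc 0 R) := by
        refine ContinuousOn.mul (ContinuousOn.rpow_const (by fun_prop) ?_) (by fun_prop)
        intro x hx
        exact Or.inl (by linarith [hx.1])
      obtain ⟨D, hD⟩ := (isCompact_Icc.image_of_continuousOn hc).bddAbove
      refine ⟨max D 1, fun x hx => ?_⟩
      rcases le_total x R with h | h
      · exact (hD ⟨x, ⟨hx, h⟩, rfl⟩).trans (le_max_left _ _)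
      · exact (hR x h).le.trans (le_max_right _ _)
    refine (h1.const_mul (Real.exp κ * D)).mono' (by fun_prop) (ae_of_all _ fun x => ?_)
    rw [Real.norm_eq_abs, Real.abs_exp]
    have hx : 0 ≤ ‖x‖ := norm_nonneg x
    have hp : (0 : ℝ) < (1 + ‖x‖) ^ r := Real.rpow_pos_of_pos (by linarith) _
    rw [Real.rpow_neg (by linarith), ← div_eq_mul_inv, le_div_iff₀ hp]
    calc Real.exp (-(κ * ‖x‖ ^ 2)) * (1 + ‖x‖) ^ r
        ≤ (Real.exp κ * Real.exp (-(κ / 2) * (1 + ‖x‖))) * (1 + ‖x‖) ^ r := by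
          rw [← Real.exp_add]
          gcongr
          nlinarith [mul_nonneg hκ.le (sq_nonneg (‖x‖ - 1)), mul_nonneg hκ.le (sq_nonneg ‖x‖)]
      _ = Real.exp κ * ((1 + ‖x‖) ^ r * Real.exp (-(κ / 2) * (1 + ‖x‖))) := by ring
      _ ≤ Real.exp κ * D := by
          gcongr
          exact hD _ hx
  exact (hint.const_mul C).lintegral_lt_top.ne

/-! ### The anisotropic change of variables. -/

/-- The real-linear map `z ↦ a (Re z + j τ Im z)`. -/
def axisScale (a : ℂ) (τ : ℝ) : ℂ →ₗ[ℝ] ℂ where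
  toFun z := a * ((z.re : ℂ) + (τ * z.im : ℝ) * Complex.I)
  map_add' x y := by
    simp only [Complex.add_re, Complex.add_im]
    push_cast
    ring
  map_smul' c x := by
    simp only [RingHom.id_apply, Complex.real_smul, Complex.re_ofReal_mul, Complex.im_ofReal_mul]
    push_cast
    ring

theorem axisScale_apply (a : ℂ) (τ : ℝ) (z : ℂ) :
    axisScale a τ z = a * ((z.re : ℂ) + (τ * z.im : ℝ) * Complex.I) := rfl

theorem det_axisScale (a : ℂ) (τ : ℝ) : LinearMap.det (axisScale a τ) = ‖a‖ ^ 2 * τ := by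
  rw [← LinearMap.det_toMatrix Complex.basisOneI, Matrix.det_fin_two, Complex.sq_norm,
    Complex.normSq_apply]
  simp [LinearMap.toMatrix_apply, axisScale_apply]
  ring

/-- Coordinatewise `axisScale`. -/
def stretch {N : ℕ} (e : Fin N → ℂ) (τ : ℝ) : (Fin N → ℂ) →ₗ[ℝ] (Fin N → ℂ) :=
  LinearMap.pi fun i => axisScale (e i) τ ∘ₗ LinearMap.proj i

theorem stretch_apply {N : ℕ} (e : Fin N → ℂ) (τ : ℝ) (c : Fin N → ℂ) (i : Fin N) :
    stretch e τ c i = e i * (((c i).re : ℂ) + (τ * (c i).im : ℝ) * Complex.I) := rfl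

theorem det_stretch {N : ℕ} {e : Fin N → ℂ} (he : ∀ i, ‖e i‖ = 1) (τ : ℝ) :
    LinearMap.det (stretch e τ) = τ ^ N := by
  rw [stretch, LinearMap.det_pi]
  simp [det_axisScale, he]

theorem continuous_stretch {N : ℕ} (e : Fin N → ℂ) (τ : ℝ) : Continuous (stretch e τ) :=
  (stretch e τ).continuous_of_finiteDimensional

/-- The source of the diversity order: only one real coordinate of each channel entry is shrunk, so
`τ = 1 / √ρ` contributes the Jacobian `ρ ^ (-N/2)`. -/
theorem lintegral_eq_lintegral_stretch {N : ℕ} {e : Fin N → ℂ} (he : ∀ i, ‖e i‖ = 1) {τ : ℝ}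
    (hτ : 0 < τ) {f : (Fin N → ℂ) × (Fin N → ℂ) → ℝ≥0∞} (hf : Measurable f) :
    ∫⁻ v, f v = ENNReal.ofReal (τ ^ N) * ∫⁻ v : (Fin N → ℂ) × (Fin N → ℂ),
      f (stretch e τ v.1, v.2) := by
  have hτN : 0 < τ ^ N := pow_pos hτ N
  have h1 := Measure.map_linearMap_addHaar_eq_smul_addHaar
    (volume : Measure (Fin N → ℂ)) (f := stretch e τ) (by rw [det_stretch he]; exact hτN.ne')
  rw [det_stretch he, abs_of_pos (inv_pos.2 hτN)] at h1
  have h2 : Measure.map (Prod.map (stretch e τ) id)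
      (volume : Measure ((Fin N → ℂ) × (Fin N → ℂ))) = ENNReal.ofReal (τ ^ N)⁻¹ • volume := by
    rw [Measure.volume_eq_prod, ← Measure.map_prod_map _ _ (continuous_stretch e τ).measurable
      measurable_id, h1, Measure.map_id, Measure.prod_smul_left]
  have h3 : ∫⁻ v : (Fin N → ℂ) × (Fin N → ℂ), f (stretch e τ v.1, v.2) =
      ENNReal.ofReal (τ ^ N)⁻¹ * ∫⁻ v, f v := by
    rw [← smul_eq_mul, ← lintegral_smul_measure, ← h2, lintegral_map hf
      ((continuous_stretch e τ).measurable.prodMap measurable_id)]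
    rfl
  rw [h3, ← mul_assoc, ← ENNReal.ofReal_mul hτN.le, mul_inv_cancel₀ hτN.ne', ENNReal.ofReal_one,
    one_mul]

/-! ### Limits of integrals over regions cut out by tests. -/

theorem eventually_pos_of_tendsto {ψ : ℝ → ℝ} {a b : ℝ} (hab : 0 < a ∨ (a = 0 ∧ 0 < b))
    (h : Tendsto (fun ρ => ψ ρ - (√ρ * a + b)) atTop (𝓝 0)) : ∀ᶠ ρ in atTop, 0 < ψ ρ := by
  rcases hab with ha | ⟨rfl, hb⟩
  · have h1 : Tendsto (fun ρ => √ρ * a + b) atTop atTop :=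
      tendsto_atTop_add_const_right _ b (Real.tendsto_sqrt_atTop.atTop_mul_const ha)
    have h2 := h.add_atTop h1
    simp only [sub_add_cancel] at h2
    exact h2.eventually_gt_atTop 0
  · have h2 : Tendsto ψ atTop (𝓝 b) := by
      simpa using h.add_const b
    exact h2.eventually (lt_mem_nhds hb)

theorem eventually_pos_or_neg_of_tendsto {ψ : ℝ → ℝ} {a b : ℝ} (hab : a ≠ 0 ∨ b ≠ 0)
    (h : Tendsto (fun ρ => ψ ρ - (√ρ * a + b)) atTop (𝓝 0)) :
    (∀ᶠ ρ in atTop, 0 < ψ ρ) ∨ (∀ᶠ ρ in atTop, ψ ρ < 0) := by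
  have hneg : Tendsto (fun ρ => -ψ ρ - (√ρ * -a + -b)) atTop (𝓝 0) := by
    rw [← neg_zero]
    exact h.neg.congr fun ρ => by ring
  have hsign : (0 < a ∨ (a = 0 ∧ 0 < b)) ∨ (0 < -a ∨ (-a = 0 ∧ 0 < -b)) := by
    rcases lt_trichotomy a 0 with ha | rfl | ha
    · exact Or.inr (Or.inl (neg_pos.2 ha))
    · rcases (hab.resolve_left fun h => h rfl).lt_or_gt with hb | hb
      · exact Or.inr (Or.inr ⟨neg_zero, neg_pos.2 hb⟩)
      · exact Or.inl (Or.inr ⟨rfl, hb⟩)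
    · exact Or.inl (Or.inl ha)
  refine hsign.imp (fun h1 => eventually_pos_of_tendsto h1 h) fun h1 => ?_
  exact (eventually_pos_of_tendsto h1 hneg).mono fun ρ hρ => neg_pos.1 hρ

/-- Integrals over sets cut out by finitely many test functions `√ρ A + B + o(1)` converge to the
integral over the set of points where all test functions are eventually positive, and it does not
matter whether the boundary is included. -/
theorem tendsto_lintegral_indicator_of_tests {V : Type*} [MeasurableSpace V] {ν : Measure V}
    {ι : Type*} [Finite ι] {ψ : ι → ℝ → V → ℝ} {A B : ι → V → ℝ}
    (hAB : ∀ k, ∀ᵐ v ∂ν, A k v ≠ 0 ∨ B k v ≠ 0)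
    (hψ : ∀ k v, Tendsto (fun ρ => ψ k ρ v - (√ρ * A k v + B k v)) atTop (𝓝 0))
    {p : ℝ → V → ℝ≥0∞} {q G : V → ℝ≥0∞} (hp : ∀ ρ, Measurable (p ρ))
    (hpq : ∀ v, Tendsto (fun ρ => p ρ v) atTop (𝓝 (q v)))
    {S : ℝ → Set V} (hS : ∀ ρ, MeasurableSet (S ρ))
    (hlo : ∀ ρ, {v | ∀ k, 0 < ψ k ρ v} ⊆ S ρ) (hhi : ∀ ρ, S ρ ⊆ {v | ∀ k, 0 ≤ ψ k ρ v})
    (hG : ∀ᶠ ρ in atTop, ∀ v, (∀ k, 0 ≤ ψ k ρ v) → p ρ v ≤ G v) (hGi : ∫⁻ v, G v ∂ν ≠ ∞) :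
    Tendsto (fun ρ => ∫⁻ v, (S ρ).indicator (p ρ) v ∂ν) atTop
      (𝓝 (∫⁻ v, {v | ∀ k, ∀ᶠ ρ in atTop, 0 < ψ k ρ v}.indicator q v ∂ν)) := by
  refine tendsto_lintegral_filter_of_dominated_convergence G
    (Eventually.of_forall fun ρ => (hp ρ).indicator (hS ρ)) ?_ hGi ?_
  · filter_upwards [hG] with ρ hρ
    refine ae_of_all _ fun v => ?_
    by_cases hv : v ∈ S ρ
    · rw [Set.indicator_of_mem hv]
      exact hρ v (hhi ρ hv)
    · rw [Set.indicator_of_notMem hv]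
      exact zero_le
  · filter_upwards [ae_all_iff.2 hAB] with v hv
    by_cases hmem : ∀ k, ∀ᶠ ρ in atTop, 0 < ψ k ρ v
    · rw [Set.indicator_of_mem (show v ∈ {v | ∀ k, ∀ᶠ ρ in atTop, 0 < ψ k ρ v} from hmem)]
      refine (hpq v).congr' ?_
      filter_upwards [eventually_all.2 hmem] with ρ hρ
      rw [Set.indicator_of_mem (hlo ρ hρ)]
    · rw [Set.indicator_of_notMem (show v ∉ {v | ∀ k, ∀ᶠ ρ in atTop, 0 < ψ k ρ v} from hmem)]
      rw [not_forall] at hmem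
      obtain ⟨k, hk⟩ := hmem
      -- A test that is not eventually positive is eventually strictly negative, so `v` leaves `S ρ`
      -- for good and ties play no role.
      have hneg := (eventually_pos_or_neg_of_tendsto (hv k) (hψ k v)).resolve_left hk
      refine tendsto_const_nhds.congr' ?_
      filter_upwards [hneg] with ρ hρ
      rw [Set.indicator_of_notMem fun h => (hhi ρ h k).not_gt hρ]

/-! ### Decision tests and their expansion in stretched coordinates. -/

section Tests

variable {N M : ℕ} (K : Matrix (Fin N) (Fin N) ℂ) (s t : ℂ) (r e : Fin N → ℂ)

/-- The comparisons that decide whether the quantizer outputs are `r` and the detected symbol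
is `t`: a competitor of `r i` for every entry `i`, or a competitor of `t`. -/
abbrev TestIndex (M : ℕ) (t : ℂ) (r : Fin N → ℂ) : Type :=
  {x : Fin N × ℂ // x.2 ∈ psk M ∧ x.2 ≠ r x.1} ⊕ {t' : ℂ // t' ∈ psk M ∧ t' ≠ t}

theorem finite_testIndex : Finite (TestIndex M t r) := by
  have h1 : Finite {x : Fin N × ℂ // x.2 ∈ psk M ∧ x.2 ≠ r x.1} :=
    Set.Finite.to_subtype ((Set.finite_univ.prod (finite_psk M)).subset
      (t := {x : Fin N × ℂ | x.2 ∈ psk M ∧ x.2 ≠ r x.1})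
      fun x hx => ⟨Set.mem_univ _, hx.1⟩)
  have h2 : Finite {t' : ℂ // t' ∈ psk M ∧ t' ≠ t} :=
    Set.Finite.to_subtype ((finite_psk M).subset (t := {t' : ℂ | t' ∈ psk M ∧ t' ≠ t})
      fun x hx => hx.1)
  infer_instance

/-- Each test compares the decided point with a competitor: it is positive if the decided point is
strictly better. -/
def decisionTest : TestIndex M t r → ℝ → (Fin N → ℂ) × (Fin N → ℂ) → ℝ
  | .inl x, ρ, v => (conj (received ρ v.1 s v.2 x.1.1) * (r x.1.1 - x.1.2)).re
  | .inr x, ρ, v => (conj (star (amrc K ρ v.1) ⬝ᵥ r) * (t - x.1)).re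

/-- The coefficient of `√ρ` in the expansion of `decisionTest` along stretched coordinates. -/
def leadCoeff : TestIndex M t r → (Fin N → ℂ) × (Fin N → ℂ) → ℝ
  | .inl x, v => (v.1 x.1.1).re * (conj (e x.1.1 * s) * (r x.1.1 - x.1.2)).re
  | .inr x, v => ∑ i, (v.1 i).re * (e i * (conj (r i) * (t - x.1))).re

/-- The constant coefficient in the expansion of `decisionTest` along stretched coordinates. -/
def constCoeff : TestIndex M t r → (Fin N → ℂ) × (Fin N → ℂ) → ℝ
  | .inl x, v =>
    (conj (e x.1.1 * ((v.1 x.1.1).im * Complex.I) * s + v.2 x.1.1) * (r x.1.1 - x.1.2)).re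
  | .inr x, v => ∑ i, (e i * ((v.1 i).im * Complex.I) * (conj (r i) * (t - x.1))).re

variable {K s t r e}

theorem conj_star_dotProduct_mul (g r : Fin N → ℂ) (u : ℂ) :
    conj (star g ⬝ᵥ r) * u = ∑ i, g i * (conj (r i) * u) := by
  rw [dotProduct, map_sum, Finset.sum_mul]
  refine Finset.sum_congr rfl fun i _ => ?_
  simp [mul_assoc]

theorem continuous_decisionTest (k : TestIndex M t r) (ρ : ℝ) :
    Continuous (decisionTest K s t r k ρ) := by
  rcases k with x | x
  · change Continuous fun v => decisionTest K s t r (.inl x) ρ v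
    simp only [decisionTest, received]
    fun_prop
  · change Continuous fun v => decisionTest K s t r (.inr x) ρ v
    have h := fun i => (continuous_apply i).comp ((continuous_amrc K ρ).comp
      (continuous_fst (X := Fin N → ℂ) (Y := Fin N → ℂ)))
    simp only [Function.comp_def] at h
    simp only [decisionTest, conj_star_dotProduct_mul]
    fun_prop

theorem continuous_leadCoeff (k : TestIndex M t r) : Continuous (leadCoeff s t r e k) := by
  change Continuous fun v => leadCoeff s t r e k v
  rcases k with x | x <;> simp only [leadCoeff] <;> fun_prop

theorem continuous_constCoeff (k : TestIndex M t r) : Continuous (constCoeff s t r e k) := by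
  change Continuous fun v => constCoeff s t r e k v
  rcases k with x | x <;> simp only [constCoeff] <;> fun_prop

theorem norm_stretch_le (he : ∀ i, ‖e i‖ = 1) {τ : ℝ} (hτ0 : 0 ≤ τ) (hτ1 : τ ≤ 1)
    (c : Fin N → ℂ) : ‖stretch e τ c‖ ≤ 2 * ‖c‖ := by
  refine (pi_norm_le_iff_of_nonneg (by positivity)).2 fun i => ?_
  rw [stretch_apply, norm_mul, he, one_mul]
  refine (norm_add_le _ _).trans ?_
  rw [norm_mul, Complex.norm_I, mul_one, Complex.norm_real, Complex.norm_real, Real.norm_eq_abs,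
    Real.norm_eq_abs, abs_mul, abs_of_nonneg hτ0]
  have h1 := Complex.abs_re_le_norm (c i)
  have h2 := Complex.abs_im_le_norm (c i)
  have h3 := norm_le_pi_norm c i
  have h4 : τ * |(c i).im| ≤ 1 * |(c i).im| := by gcongr
  linarith

theorem abs_re_le_norm_stretch (he : ∀ i, ‖e i‖ = 1) (τ : ℝ) (c : Fin N → ℂ) (i : Fin N) :
    |(c i).re| ≤ ‖stretch e τ c‖ := by
  refine le_trans ?_ (norm_le_pi_norm _ i)
  rw [stretch_apply, norm_mul, he, one_mul]
  refine le_trans (le_of_eq ?_) (Complex.abs_re_le_norm _)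
  simp

theorem sqrt_mul_stretch {ρ : ℝ} (hρ : 0 < ρ) (c : Fin N → ℂ) (i : Fin N) :
    (√ρ : ℂ) * stretch e (√ρ)⁻¹ c i = √ρ * (c i).re * e i + e i * ((c i).im * Complex.I) := by
  have h : (√ρ : ℂ) ≠ 0 := by exact_mod_cast (Real.sqrt_pos.2 hρ).ne'
  rw [stretch_apply]
  push_cast
  field_simp

/-- For quantizer tests the expansion is exact once `ρ > 0`. For detector tests the only remainder
comes from replacing the combiner by `√ρ h`, which costs `O(1 / √ρ)` for fixed `v`. -/
theorem tendsto_decisionTest_sub (hK : K.PosDef) (he : ∀ i, ‖e i‖ = 1) (k : TestIndex M t r)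
    (v : (Fin N → ℂ) × (Fin N → ℂ)) :
    Tendsto (fun ρ => decisionTest K s t r k ρ (stretch e (√ρ)⁻¹ v.1, v.2) -
      (√ρ * leadCoeff s t r e k v + constCoeff s t r e k v)) atTop (𝓝 0) := by
  rcases k with x | x
  · refine tendsto_const_nhds.congr' ?_
    filter_upwards [eventually_gt_atTop 0] with ρ hρ
    simp only [decisionTest, leadCoeff, constCoeff, received]
    rw [sqrt_mul_stretch hρ]
    have h : conj ((√ρ * (v.1 x.1.1).re * e x.1.1 + e x.1.1 * ((v.1 x.1.1).im * Complex.I)) * s +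
        v.2 x.1.1) * (r x.1.1 - x.1.2) =
        ((√ρ * (v.1 x.1.1).re : ℝ) : ℂ) * (conj (e x.1.1 * s) * (r x.1.1 - x.1.2)) +
        conj (e x.1.1 * ((v.1 x.1.1).im * Complex.I) * s + v.2 x.1.1) * (r x.1.1 - x.1.2) := by
      simp only [map_add, map_mul, Complex.conj_ofReal]
      push_cast
      ring
    rw [h, Complex.add_re, Complex.re_ofReal_mul]
    ring
  · obtain ⟨C, hC, hamrc⟩ := exists_norm_amrc_sub_le hK
    have hb : Tendsto (fun ρ : ℝ => N * (C / √ρ * (2 * ‖v.1‖)) *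
        (∑ i, ‖conj (r i) * (t - x.1)‖)) atTop (𝓝 0) := by
      have := (((tendsto_const_nhds (x := C)).div_atTop Real.tendsto_sqrt_atTop).mul_const
        (2 * ‖v.1‖)).const_mul (N : ℝ)
      simpa using this.mul_const (∑ i, ‖conj (r i) * (t - x.1)‖)
    refine squeeze_zero_norm' ?_ hb
    filter_upwards [eventually_ge_atTop 1] with ρ hρ
    have hρ0 : 0 < ρ := by linarith
    have hs1 : 1 ≤ √ρ := Real.one_le_sqrt.2 hρ
    set y := stretch e (√ρ)⁻¹ v.1 with hy
    have hyn : ‖y‖ ≤ 2 * ‖v.1‖ :=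
      norm_stretch_le he (by positivity) (inv_le_one_of_one_le₀ hs1) _
    simp only [decisionTest, leadCoeff, constCoeff]
    rw [conj_star_dotProduct_mul]
    have h : (∑ i, amrc K ρ y i * (conj (r i) * (t - x.1))).re -
        (√ρ * ∑ i, (v.1 i).re * (e i * (conj (r i) * (t - x.1))).re +
          ∑ i, (e i * ((v.1 i).im * Complex.I) * (conj (r i) * (t - x.1))).re) =
        ∑ i, ((amrc K ρ y i - √ρ * y i) * (conj (r i) * (t - x.1))).re := by
      rw [Complex.re_sum, Finset.mul_sum, ← Finset.sum_add_distrib, ← Finset.sum_sub_distrib]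
      refine Finset.sum_congr rfl fun i _ => ?_
      have h2 : √ρ * y i * (conj (r i) * (t - x.1)) =
          ((√ρ * (v.1 i).re : ℝ) : ℂ) * (e i * (conj (r i) * (t - x.1))) +
          e i * ((v.1 i).im * Complex.I) * (conj (r i) * (t - x.1)) := by
        rw [hy, sqrt_mul_stretch hρ0]
        push_cast
        ring
      rw [sub_mul, Complex.sub_re, h2, Complex.add_re, Complex.re_ofReal_mul]
      ring
    rw [h, Real.norm_eq_abs]
    refine (Finset.abs_sum_le_sum_abs _ _).trans ?_
    rw [Finset.mul_sum]
    refine Finset.sum_le_sum fun i _ => ?_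
    refine (Complex.abs_re_le_norm _).trans ?_
    rw [norm_mul]
    have hN : (1 : ℝ) ≤ N := by exact_mod_cast Fin.pos i
    gcongr
    refine (hamrc ρ hρ0 y i).trans ?_
    calc C / √ρ * ‖y‖ ≤ 1 * (C / √ρ * (2 * ‖v.1‖)) := by
          rw [one_mul]
          gcongr
      _ ≤ N * (C / √ρ * (2 * ‖v.1‖)) := by gcongr

theorem ae_linearMap_ne_zero {V : Type*} [NormedAddCommGroup V] [NormedSpace ℝ V]
    [FiniteDimensional ℝ V] [MeasurableSpace V] [BorelSpace V] (ν : Measure V)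
    [ν.IsAddHaarMeasure] (f : V →ₗ[ℝ] ℝ) (hf : f ≠ 0) : ∀ᵐ v ∂ν, f v ≠ 0 := by
  have h := Measure.addHaar_submodule ν (LinearMap.ker f) fun h => hf (LinearMap.ker_eq_top.1 h)
  rw [ae_iff]
  simp only [ne_eq, not_not]
  exact h

/-- The real-linear functional `v ↦ Re (∑ i, (v.1 i * a i + v.2 i * b i))`. -/
def pairFunctional (a b : Fin N → ℂ) : (Fin N → ℂ) × (Fin N → ℂ) →ₗ[ℝ] ℝ where
  toFun v := (∑ i, (v.1 i * a i + v.2 i * b i)).re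
  map_add' v w := by
    rw [← Complex.add_re, ← Finset.sum_add_distrib]
    congr 1
    refine Finset.sum_congr rfl fun i _ => ?_
    simp only [Prod.fst_add, Prod.snd_add, Pi.add_apply]
    ring
  map_smul' c v := by
    rw [RingHom.id_apply, smul_eq_mul, ← Complex.re_ofReal_mul, Finset.mul_sum]
    congr 1
    refine Finset.sum_congr rfl fun i _ => ?_
    simp only [Prod.smul_fst, Prod.smul_snd, Pi.smul_apply, Complex.real_smul]
    ring

theorem pairFunctional_apply (a b : Fin N → ℂ) (v : (Fin N → ℂ) × (Fin N → ℂ)) :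
    pairFunctional a b v = (∑ i, (v.1 i * a i + v.2 i * b i)).re := rfl

theorem pairFunctional_ne_zero {a : Fin N → ℂ} (b : Fin N → ℂ) {i : Fin N} (ha : a i ≠ 0) :
    pairFunctional a b ≠ 0 := by
  classical
  intro h
  have h1 := LinearMap.congr_fun h (Pi.single i (conj (a i)), 0)
  rw [pairFunctional_apply, Finset.sum_eq_single i] at h1
  · simp only [Pi.single_eq_same, Pi.zero_apply, zero_mul, add_zero, LinearMap.zero_apply,
      ← Complex.normSq_eq_conj_mul_self, Complex.ofReal_re, Complex.normSq_eq_zero] at h1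
    exact ha h1
  · intro j _ hj
    simp [hj]
  · simp

instance isAddHaarMeasure_volume_pair :
    (volume : Measure ((Fin N → ℂ) × (Fin N → ℂ))).IsAddHaarMeasure :=
  Measure.prod.instIsAddHaarMeasure (volume : Measure (Fin N → ℂ)) (volume : Measure (Fin N → ℂ))

/-- Where both coefficients vanish their sum vanishes too, and the sum is a nonzero real-linear
functional of `v`, whose kernel is a null set. -/
theorem ae_leadCoeff_or_constCoeff_ne_zero (hN : 0 < N) (he : ∀ i, ‖e i‖ = 1) (hs : s ≠ 0)
    (hr : ∀ i, r i ≠ 0) (k : TestIndex M t r) :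
    ∀ᵐ v : (Fin N → ℂ) × (Fin N → ℂ),
      leadCoeff s t r e k v ≠ 0 ∨ constCoeff s t r e k v ≠ 0 := by
  classical
  have he0 : ∀ i, e i ≠ 0 := fun i => norm_ne_zero_iff.1 (by rw [he]; exact one_ne_zero)
  suffices h : ∃ a b i, a i ≠ 0 ∧ ∀ v, pairFunctional a b v =
      leadCoeff s t r e k v + constCoeff s t r e k v by
    obtain ⟨a, b, i, ha, h⟩ := h
    filter_upwards [ae_linearMap_ne_zero volume _ (pairFunctional_ne_zero b ha)] with v hv
    rw [h] at hv
    by_contra! h0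
    exact hv (by rw [h0.1, h0.2, add_zero])
  rcases k with ⟨⟨i, r'⟩, hr', hne⟩ | ⟨t', ht', hne⟩
  · have hu : r i - r' ≠ 0 := sub_ne_zero.2 (Ne.symm hne)
    refine ⟨Pi.single i (e i * s * conj (r i - r')), Pi.single i (conj (r i - r')), i, ?_, ?_⟩
    · rw [Pi.single_eq_same]
      exact mul_ne_zero (mul_ne_zero (he0 i) hs) ((map_ne_zero _).2 hu)
    · intro v
      rw [pairFunctional_apply, Finset.sum_eq_single i]
      · simp only [leadCoeff, constCoeff, Pi.single_eq_same]
        rw [← Complex.re_ofReal_mul, ← Complex.add_re, ← Complex.conj_re]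
        congr 1
        conv_lhs => rw [← Complex.re_add_im (v.1 i)]
        simp only [map_add, map_mul, map_sub, Complex.conj_conj, Complex.conj_ofReal]
        ring
      · intro j _ hj
        simp [hj]
      · simp
  · have hu : t - t' ≠ 0 := sub_ne_zero.2 (Ne.symm hne)
    refine ⟨fun i => e i * (conj (r i) * (t - t')), 0, ⟨0, hN⟩, ?_, ?_⟩
    · exact mul_ne_zero (he0 _) (mul_ne_zero ((map_ne_zero _).2 (hr _)) hu)
    · intro v
      simp only [pairFunctional_apply, leadCoeff, constCoeff]
      rw [Complex.re_sum, ← Finset.sum_add_distrib]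
      refine Finset.sum_congr rfl fun i _ => ?_
      rw [← Complex.re_ofReal_mul, ← Complex.add_re]
      congr 1
      conv_lhs => rw [← Complex.re_add_im (v.1 i)]
      simp only [Pi.zero_apply]
      ring

end Tests

/-! ### Domination and the limiting mass of one error pattern. -/

section Limit

variable {N M : ℕ} {K : Matrix (Fin N) (Fin N) ℂ} {s t : ℂ} {r e : Fin N → ℂ} {δ : ℝ}

/-- The joint density of the channel and the noise. -/
def jointDensity (K : Matrix (Fin N) (Fin N) ℂ) (v : (Fin N → ℂ) × (Fin N → ℂ)) : ℝ :=
  gaussianDensity K v.1 * gaussianDensity 1 v.2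

theorem continuous_jointDensity (K : Matrix (Fin N) (Fin N) ℂ) : Continuous (jointDensity K) :=
  ((continuous_gaussianDensity K).comp continuous_fst).mul
    ((continuous_gaussianDensity 1).comp continuous_snd)

theorem jointDensity_pos (hK : K.PosDef) (v : (Fin N → ℂ) × (Fin N → ℂ)) : 0 < jointDensity K v :=
  mul_pos (gaussianDensity_pos hK _) (gaussianDensity_pos Matrix.PosDef.one _)

/-- If the quantizer outputs are `r` and the detector prefers `t` to the transmitted symbol `s`,
then the transversal coordinates of the channel are controlled by the noise. -/
theorem abs_im_le_of_decisionTest_nonneg (hM : M ≠ 0) (hs : s ∈ psk M) (ht : t ∈ psk M)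
    (hst : t ≠ s) (hr : ∀ i, r i ∈ psk M) (he : ∀ i, ‖e i‖ = 1)
    (hδ : 0 < δ) (hu : ∀ i, conj (e i * s) * (r i * (1 - s / t)) = δ * Complex.I)
    {C ρ : ℝ} (hC : 0 ≤ C) (hρ : 1 ≤ ρ)
    (hamrc : ∀ (x : Fin N → ℂ) (i : Fin N), ‖amrc K ρ x i - (√ρ : ℂ) * x i‖ ≤ C / √ρ * ‖x‖)
    (v : (Fin N → ℂ) × (Fin N → ℂ))
    (htest : ∀ k : TestIndex M t r, 0 ≤ decisionTest K s t r k ρ (stretch e (√ρ)⁻¹ v.1, v.2))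
    (i : Fin N) :
    |(v.1 i).im| ≤ N * (C * ‖stretch e (√ρ)⁻¹ v.1‖ + ‖v.2‖) := by
  have hρ0 : 0 < ρ := by linarith
  have hs1 : 1 ≤ √ρ := Real.one_le_sqrt.2 hρ
  have hs0 := ne_zero_of_mem_psk hs
  have ht0 := ne_zero_of_mem_psk ht
  have hN : (1 : ℝ) ≤ N := by exact_mod_cast Fin.pos i
  have hun : ∀ j, ‖r j * (1 - s / t)‖ = δ := by
    intro j
    have h := congrArg norm (hu j)
    rwa [norm_mul, Complex.norm_conj, norm_mul, he, norm_of_mem_psk hs, one_mul, one_mul,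
      norm_mul (δ : ℂ), Complex.norm_I, mul_one, Complex.norm_real, Real.norm_eq_abs, abs_of_pos hδ] at h
  set x := stretch e (√ρ)⁻¹ v.1 with hx
  -- the quantizer bounds the transversal coordinates from below
  have hlow : ∀ j, -‖v.2‖ ≤ (v.1 j).im := by
    intro j
    have hne : r j * s / t ≠ r j := by
      rw [mul_div_assoc]
      intro h
      have h1 : s / t = 1 := by
        simpa [ne_zero_of_mem_psk (hr j)] using h
      exact hst ((div_eq_one_iff_eq ht0).1 h1).symm
    -- This competitor differs from `r j` by `r j * (1 - s / t)`, the vector orthogonal to `e j *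
    -- s`; the large longitudinal coordinate therefore drops out of the real part.
    have h := htest (.inl ⟨(j, r j * s / t), mul_div_mem_psk hM (hr j) hs ht, hne⟩)
    simp only [decisionTest, received] at h
    have h1 : conj ((√ρ : ℂ) * x j * s + v.2 j) * (r j - r j * s / t) =
        ((√ρ * (v.1 j).re * δ : ℝ) : ℂ) * Complex.I + (((v.1 j).im * δ : ℝ) : ℂ) +
          conj (v.2 j) * (r j * (1 - s / t)) := by
      have h2 : r j - r j * s / t = r j * (1 - s / t) := by ring
      have h3 : (√ρ : ℂ) * x j * s =
          (√ρ * (v.1 j).re + (v.1 j).im * Complex.I) * (e j * s) := by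
        rw [hx, sqrt_mul_stretch hρ0]
        ring
      rw [h2, h3, map_add, add_mul, map_mul, mul_assoc, hu]
      simp only [map_add, map_mul, Complex.conj_ofReal, Complex.conj_I]
      push_cast
      linear_combination (-(v.1 j).im * δ : ℂ) * Complex.I_mul_I
    rw [h1] at h
    have h4 := Complex.abs_re_le_norm (conj (v.2 j) * (r j * (1 - s / t)))
    rw [norm_mul, hun, Complex.norm_conj] at h4
    simp only [Complex.add_re, Complex.re_ofReal_mul, Complex.I_re, mul_zero, zero_add,
      Complex.ofReal_re] at h
    have h5 := (abs_le.1 h4).2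
    have h6 : 0 ≤ ((v.1 j).im + ‖v.2 j‖) * δ := by linarith
    have h7 := nonneg_of_mul_nonneg_left h6 hδ
    have h8 := norm_le_pi_norm v.2 j
    linarith
  -- the detector bounds their sum from above
  have hsum : ∑ j, (v.1 j).im ≤ N * (C * ‖x‖) := by
    have h := htest (.inr ⟨s, hs, Ne.symm hst⟩)
    simp only [decisionTest] at h
    rw [conj_star_dotProduct_mul] at h
    -- Since `s` and `t` have modulus one, the detector sees the same vectors as the quantizer
    -- tests, conjugated and with the opposite sign. This turns lower bounds on single entries into
    -- an upper bound on their sum.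
    have hconj : ∀ j, conj (r j) * (t - s) = -(s * conj (r j * (1 - s / t))) := by
      intro j
      have h1 : conj s = s⁻¹ := (Complex.inv_eq_conj (norm_of_mem_psk hs)).symm
      have h2 : conj t = t⁻¹ := (Complex.inv_eq_conj (norm_of_mem_psk ht)).symm
      simp only [map_mul, map_sub, map_one, map_div₀, h1, h2]
      field_simp
      ring
    have hterm : ∀ j, (amrc K ρ x j * (conj (r j) * (t - s))).re ≤
        -((v.1 j).im * δ) + C * ‖x‖ * δ := by
      intro j
      have h1 : amrc K ρ x j * (conj (r j) * (t - s)) =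
          -conj (((√ρ * (v.1 j).re * δ : ℝ) : ℂ) * Complex.I + (((v.1 j).im * δ : ℝ) : ℂ)) +
          (amrc K ρ x j - √ρ * x j) * (conj (r j) * (t - s)) := by
        have h3 : (√ρ : ℂ) * x j * s =
            (√ρ * (v.1 j).re + (v.1 j).im * Complex.I) * (e j * s) := by
          rw [hx, sqrt_mul_stretch hρ0]
          ring
        have h4 : (√ρ : ℂ) * x j * s * conj (r j * (1 - s / t)) =
            conj (((√ρ * (v.1 j).re * δ : ℝ) : ℂ) * Complex.I + (((v.1 j).im * δ : ℝ) : ℂ)) := by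
          have h5 := congrArg conj (hu j)
          rw [map_mul, Complex.conj_conj] at h5
          rw [h3, mul_assoc, h5]
          simp only [map_add, map_mul, Complex.conj_ofReal, Complex.conj_I]
          push_cast
          linear_combination (-(v.1 j).im * δ : ℂ) * Complex.I_mul_I
        rw [← h4, hconj]
        ring
      have h2 : ‖(amrc K ρ x j - √ρ * x j) * (conj (r j) * (t - s))‖ ≤ C * ‖x‖ * δ := by
        rw [norm_mul, hconj, norm_neg, norm_mul, Complex.norm_conj, hun, norm_of_mem_psk hs,
          one_mul]
        gcongr
        refine (hamrc x j).trans ?_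
        gcongr
        exact div_le_self hC hs1
      rw [h1, Complex.add_re, Complex.neg_re, Complex.conj_re]
      have h3 := (abs_le.1 (Complex.abs_re_le_norm
        ((amrc K ρ x j - √ρ * x j) * (conj (r j) * (t - s))))).2
      simp only [Complex.add_re, Complex.re_ofReal_mul, Complex.I_re, mul_zero, zero_add,
        Complex.ofReal_re]
      linarith
    rw [Complex.re_sum] at h
    have h1 := h.trans (Finset.sum_le_sum fun j _ => hterm j)
    rw [Finset.sum_add_distrib, Finset.sum_neg_distrib, ← Finset.sum_mul, Finset.sum_const,
      Finset.card_univ, Fintype.card_fin, nsmul_eq_mul] at h1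
    have h2 : (∑ j, (v.1 j).im) * δ ≤ N * (C * ‖x‖) * δ := by linarith
    exact le_of_mul_le_mul_right h2 hδ
  -- After adding `‖v.2‖` all transversal coordinates are nonnegative, so each is at most the
  -- shifted sum.
  have hup : (v.1 i).im ≤ N * (C * ‖x‖ + ‖v.2‖) := by
    have h1 : (v.1 i).im + ‖v.2‖ ≤ ∑ j, ((v.1 j).im + ‖v.2‖) :=
      Finset.single_le_sum (f := fun j => (v.1 j).im + ‖v.2‖)
        (fun j _ => by linarith [hlow j]) (Finset.mem_univ i)
    rw [Finset.sum_add_distrib, Finset.sum_const, Finset.card_univ, Fintype.card_fin,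
      nsmul_eq_mul] at h1
    have := norm_nonneg v.2
    linarith
  refine abs_le.2 ⟨?_, hup⟩
  have h1 : ‖v.2‖ ≤ C * ‖x‖ + ‖v.2‖ := le_add_of_nonneg_left (by positivity)
  have h2 : C * ‖x‖ + ‖v.2‖ ≤ N * (C * ‖x‖ + ‖v.2‖) := le_mul_of_one_le_left (by positivity) hN
  linarith [hlow i]

/-- A Gaussian bound for the joint density on the region where the tests are passed. -/
theorem exists_jointDensity_le (hK : K.PosDef) (hM : M ≠ 0) (hs : s ∈ psk M) (ht : t ∈ psk M)
    (hst : t ≠ s) (hr : ∀ i, r i ∈ psk M) (he : ∀ i, ‖e i‖ = 1) (hδ : 0 < δ)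
    (hu : ∀ i, conj (e i * s) * (r i * (1 - s / t)) = δ * Complex.I) :
    ∃ A κ : ℝ, 0 < κ ∧ ∀ ρ : ℝ, 1 ≤ ρ → ∀ v : (Fin N → ℂ) × (Fin N → ℂ),
      (∀ k : TestIndex M t r, 0 ≤ decisionTest K s t r k ρ (stretch e (√ρ)⁻¹ v.1, v.2)) →
      jointDensity K (stretch e (√ρ)⁻¹ v.1, v.2) ≤ A * Real.exp (-(κ * ‖v‖ ^ 2)) := by
  obtain ⟨C, hC, hamrc⟩ := exists_norm_amrc_sub_le hK
  obtain ⟨A₁, α₁, hA₁, hα₁, h₁⟩ := exists_gaussianDensity_le hK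
  obtain ⟨A₂, α₂, hA₂, hα₂, h₂⟩ :=
    exists_gaussianDensity_le (Matrix.PosDef.one (n := Fin N) (R := ℂ))
  set m := min α₁ α₂ with hm
  have hm0 : 0 < m := lt_min hα₁ hα₂
  -- `D` collects `|re| ≤ ‖x‖` and `|im| ≤ N (C ‖x‖ + ‖w‖)`, so that `‖v‖ ≤ D (‖x‖ + ‖w‖)`. The
  -- factor 2 in `κ` below comes from `(a + b)² ≤ 2 (a² + b²)`.
  set D : ℝ := 1 + N + N * C with hD
  have hD0 : 1 ≤ D := by
    have : (0 : ℝ) ≤ N := Nat.cast_nonneg _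
    have := mul_nonneg this hC
    linarith
  refine ⟨A₁ * A₂, m / (2 * D ^ 2), by positivity, fun ρ hρ v htest => ?_⟩
  have him := abs_im_le_of_decisionTest_nonneg hM hs ht hst hr he hδ hu hC hρ
    (hamrc ρ (by linarith)) v htest
  set x := stretch e (√ρ)⁻¹ v.1 with hx
  have hx0 := norm_nonneg x
  have hw0 := norm_nonneg v.2
  have hv : ‖v‖ ≤ D * (‖x‖ + ‖v.2‖) := by
    have hN0 : (0 : ℝ) ≤ N := Nat.cast_nonneg _
    have hNC := mul_nonneg hN0 hC
    refine norm_prod_le_iff.2 ⟨(pi_norm_le_iff_of_nonneg (by positivity)).2 fun i => ?_, ?_⟩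
    · have h3 := Complex.norm_le_abs_re_add_abs_im (v.1 i)
      have h4 := abs_re_le_norm_stretch he (√ρ)⁻¹ v.1 i
      have h5 := him i
      rw [← hx] at h4
      rw [hD]
      nlinarith [mul_nonneg hNC hw0, mul_nonneg hN0 hx0, mul_nonneg hN0 hw0]
    · nlinarith
  have hsq : ‖v‖ ^ 2 ≤ 2 * D ^ 2 * (‖x‖ ^ 2 + ‖v.2‖ ^ 2) := by
    calc ‖v‖ ^ 2 ≤ (D * (‖x‖ + ‖v.2‖)) ^ 2 := by gcongr
      _ = D ^ 2 * (‖x‖ + ‖v.2‖) ^ 2 := by ring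
      _ ≤ D ^ 2 * (2 * (‖x‖ ^ 2 + ‖v.2‖ ^ 2)) := by
          gcongr
          nlinarith [sq_nonneg (‖x‖ - ‖v.2‖)]
      _ = _ := by ring
  have hexp : m / (2 * D ^ 2) * ‖v‖ ^ 2 ≤ α₁ * ‖x‖ ^ 2 + α₂ * ‖v.2‖ ^ 2 := by
    calc m / (2 * D ^ 2) * ‖v‖ ^ 2 ≤ m / (2 * D ^ 2) * (2 * D ^ 2 * (‖x‖ ^ 2 + ‖v.2‖ ^ 2)) := by
          gcongr
      _ = m * ‖x‖ ^ 2 + m * ‖v.2‖ ^ 2 := by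
          field_simp
      _ ≤ α₁ * ‖x‖ ^ 2 + α₂ * ‖v.2‖ ^ 2 := by
          gcongr
          · exact min_le_left _ _
          · exact min_le_right _ _
  calc jointDensity K (x, v.2) ≤
        (A₁ * Real.exp (-(α₁ * ‖x‖ ^ 2))) * (A₂ * Real.exp (-(α₂ * ‖v.2‖ ^ 2))) :=
        mul_le_mul (h₁ x) (h₂ v.2) (gaussianDensity_pos Matrix.PosDef.one _).le (by positivity)
    _ = A₁ * A₂ * Real.exp (-(α₁ * ‖x‖ ^ 2 + α₂ * ‖v.2‖ ^ 2)) := by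
        rw [neg_add, Real.exp_add]
        ring
    _ ≤ A₁ * A₂ * Real.exp (-(m / (2 * D ^ 2) * ‖v‖ ^ 2)) := by gcongr

/-- The joint law of the channel and the noise. -/
def jointLaw (K : Matrix (Fin N) (Fin N) ℂ) : Measure ((Fin N → ℂ) × (Fin N → ℂ)) :=
  (complexGaussian K).prod (complexGaussian 1)

theorem jointLaw_apply (hK : K.PosDef) {S : Set ((Fin N → ℂ) × (Fin N → ℂ))}
    (hS : MeasurableSet S) :
    jointLaw K S = ∫⁻ v, S.indicator (fun v => ENNReal.ofReal (jointDensity K v)) v := by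
  have h : jointLaw K = volume.withDensity fun v => ENNReal.ofReal (jointDensity K v) := by
    have h1 : ∀ A : Matrix (Fin N) (Fin N) ℂ, complexGaussian A =
      volume.withDensity fun z => ENNReal.ofReal (gaussianDensity A z) := fun A => rfl
    rw [jointLaw, h1, h1, prod_withDensity (continuous_gaussianDensity K).measurable.ennreal_ofReal
      (continuous_gaussianDensity 1).measurable.ennreal_ofReal, Measure.volume_eq_prod]
    congr 1
    ext v
    rw [jointDensity, ENNReal.ofReal_mul (gaussianDensity_pos hK _).le]
  rw [h, withDensity_apply _ hS, lintegral_indicator hS]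

/-- The limit of `ρ ^ (N / 2)` times the probability that, when `s` is sent, the quantizer
outputs are `r` and the detected symbol is `t`. -/
def limitMass (M : ℕ) (K : Matrix (Fin N) (Fin N) ℂ) (s t : ℂ) (r e : Fin N → ℂ) : ℝ≥0∞ :=
  ∫⁻ v : (Fin N → ℂ) × (Fin N → ℂ),
    {v | ∀ k : TestIndex M t r, ∀ᶠ ρ in atTop,
      0 < decisionTest K s t r k ρ (stretch e (√ρ)⁻¹ v.1, v.2)}.indicator
    (fun v => ENNReal.ofReal (jointDensity K (stretch e 0 v.1, v.2))) v

/-- `S` may be any measurable family between the strict and the weak region; the common limit is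
what makes tie-breaking irrelevant. -/
theorem tendsto_jointLaw (hK : K.PosDef) (hM : M ≠ 0) (hN : 0 < N) (hs : s ∈ psk M)
    (ht : t ∈ psk M) (hst : t ≠ s) (hr : ∀ i, r i ∈ psk M) (he : ∀ i, ‖e i‖ = 1) (hδ : 0 < δ)
    (hu : ∀ i, conj (e i * s) * (r i * (1 - s / t)) = δ * Complex.I)
    {S : ℝ → Set ((Fin N → ℂ) × (Fin N → ℂ))} (hS : ∀ ρ, MeasurableSet (S ρ))
    (hlo : ∀ ρ, {v | ∀ k : TestIndex M t r, 0 < decisionTest K s t r k ρ v} ⊆ S ρ)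
    (hhi : ∀ ρ, S ρ ⊆ {v | ∀ k : TestIndex M t r, 0 ≤ decisionTest K s t r k ρ v}) :
    Tendsto (fun ρ => ENNReal.ofReal (√ρ ^ N) * jointLaw K (S ρ)) atTop
      (𝓝 (limitMass M K s t r e)) ∧ limitMass M K s t r e ≠ ∞ := by
  have := finite_testIndex (M := M) t r
  obtain ⟨A, κ, hκ, hA⟩ := exists_jointDensity_le hK hM hs ht hst hr he hδ hu
  have hstr : ∀ τ : ℝ, Continuous fun v : (Fin N → ℂ) × (Fin N → ℂ) => (stretch e τ v.1, v.2) :=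
    fun τ => ((continuous_stretch e τ).comp continuous_fst).prodMk continuous_snd
  have hG := lintegral_exp_neg_mul_sq_norm_ne_top
    (volume : Measure ((Fin N → ℂ) × (Fin N → ℂ))) hκ A
  have hGe : ∀ᶠ ρ : ℝ in atTop, ∀ v : (Fin N → ℂ) × (Fin N → ℂ),
      (∀ k : TestIndex M t r, 0 ≤ decisionTest K s t r k ρ (stretch e (√ρ)⁻¹ v.1, v.2)) →
      ENNReal.ofReal (jointDensity K (stretch e (√ρ)⁻¹ v.1, v.2)) ≤
        ENNReal.ofReal (A * Real.exp (-(κ * ‖v‖ ^ 2))) := by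
    filter_upwards [eventually_ge_atTop 1] with ρ hρ v hv
    exact ENNReal.ofReal_le_ofReal (hA ρ hρ v hv)
  have hinv : Tendsto (fun ρ : ℝ => (√ρ)⁻¹) atTop (𝓝 0) :=
    tendsto_inv_atTop_zero.comp Real.tendsto_sqrt_atTop
  have hq : ∀ v : (Fin N → ℂ) × (Fin N → ℂ), Tendsto
      (fun ρ => ENNReal.ofReal (jointDensity K (stretch e (√ρ)⁻¹ v.1, v.2))) atTop
      (𝓝 (ENNReal.ofReal (jointDensity K (stretch e 0 v.1, v.2)))) := by
    intro v
    have hc : Continuous fun τ : ℝ => ((stretch e τ v.1, v.2) : (Fin N → ℂ) × (Fin N → ℂ)) := by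
      refine (continuous_pi fun i => ?_).prodMk continuous_const
      simp only [stretch_apply]
      fun_prop
    exact ENNReal.tendsto_ofReal
      ((((continuous_jointDensity K).comp hc).tendsto 0).comp hinv)
  have hS' : ∀ ρ : ℝ, MeasurableSet {v : (Fin N → ℂ) × (Fin N → ℂ) |
      (stretch e (√ρ)⁻¹ v.1, v.2) ∈ S ρ} := fun ρ => (hstr _).measurable (hS ρ)
  have hp : ∀ ρ : ℝ, Measurable fun v : (Fin N → ℂ) × (Fin N → ℂ) =>
      ENNReal.ofReal (jointDensity K (stretch e (√ρ)⁻¹ v.1, v.2)) :=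
    fun ρ => ((continuous_jointDensity K).comp (hstr _)).measurable.ennreal_ofReal
  have hmain := tendsto_lintegral_indicator_of_tests
    (ψ := fun k ρ (v : (Fin N → ℂ) × (Fin N → ℂ)) =>
      decisionTest (M := M) K s t r k ρ (stretch e (√ρ)⁻¹ v.1, v.2))
    (p := fun ρ (v : (Fin N → ℂ) × (Fin N → ℂ)) =>
      ENNReal.ofReal (jointDensity K (stretch e (√ρ)⁻¹ v.1, v.2)))
    (q := fun v : (Fin N → ℂ) × (Fin N → ℂ) =>
      ENNReal.ofReal (jointDensity K (stretch e 0 v.1, v.2)))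
    (S := fun ρ => {v : (Fin N → ℂ) × (Fin N → ℂ) | (stretch e (√ρ)⁻¹ v.1, v.2) ∈ S ρ})
    (ae_leadCoeff_or_constCoeff_ne_zero hN he (ne_zero_of_mem_psk hs)
      fun i => ne_zero_of_mem_psk (hr i))
    (tendsto_decisionTest_sub hK he)
    hp hq hS' (fun ρ v hv => hlo ρ hv) (fun ρ v hv => hhi ρ hv) hGe hG
  have heq : ∀ᶠ ρ : ℝ in atTop, ∫⁻ v : (Fin N → ℂ) × (Fin N → ℂ),
      {v : (Fin N → ℂ) × (Fin N → ℂ) | (stretch e (√ρ)⁻¹ v.1, v.2) ∈ S ρ}.indicator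
        (fun v => ENNReal.ofReal (jointDensity K (stretch e (√ρ)⁻¹ v.1, v.2))) v =
      ENNReal.ofReal (√ρ ^ N) * jointLaw K (S ρ) := by
    filter_upwards [eventually_gt_atTop 0] with ρ hρ
    have hsp := Real.sqrt_pos.2 hρ
    rw [jointLaw_apply hK (hS ρ), lintegral_eq_lintegral_stretch he (inv_pos.2 hsp)
      ((continuous_jointDensity K).measurable.ennreal_ofReal.indicator (hS ρ)), ← mul_assoc,
      ← ENNReal.ofReal_mul (by positivity), ← mul_pow, mul_inv_cancel₀ hsp.ne', one_pow,
      ENNReal.ofReal_one, one_mul]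
    rfl
  refine ⟨hmain.congr' heq, ne_top_of_le_ne_top hG (le_of_tendsto hmain ?_)⟩
  filter_upwards [hGe] with ρ hρ
  refine lintegral_mono fun v => ?_
  by_cases hv : (stretch e (√ρ)⁻¹ v.1, v.2) ∈ S ρ
  · rw [Set.indicator_of_mem (by exact hv)]
    exact hρ v (hhi ρ hv)
  · rw [Set.indicator_of_notMem (by exact hv)]
    exact zero_le
-- Take `e i * s` orthogonal to `r i * (1 - s / t)`, that is, along the quantizer boundary between
-- `r i` and `r i * s / t`. The constant `δ = ‖1 - s / t‖` does not depend on `i` because `‖r i‖ =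
-- 1`.
theorem exists_unit_directions (hs : s ∈ psk M) (ht : t ∈ psk M) (hst : t ≠ s)
    (hr : ∀ i, r i ∈ psk M) : ∃ (e : Fin N → ℂ) (δ : ℝ), (∀ i, ‖e i‖ = 1) ∧ 0 < δ ∧
      ∀ i, conj (e i * s) * (r i * (1 - s / t)) = δ * Complex.I := by
  have ht0 := ne_zero_of_mem_psk ht
  have hs0 := ne_zero_of_mem_psk hs
  have hω : 1 - s / t ≠ 0 := by
    rw [sub_ne_zero]
    intro h
    exact hst ((div_eq_one_iff_eq ht0).1 h.symm).symm
  have hωn : ‖1 - s / t‖ ≠ 0 := norm_ne_zero_iff.2 hω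
  refine ⟨fun i => -Complex.I * (r i * (1 - s / t)) / ‖1 - s / t‖ / s, ‖1 - s / t‖, fun i => ?_,
    norm_pos_iff.2 hω, fun i => ?_⟩
  · simp [norm_of_mem_psk hs, norm_of_mem_psk (hr i), hωn]
  · rw [div_mul_cancel₀ _ hs0]
    have h1 : conj (r i * (1 - s / t)) * (r i * (1 - s / t)) = (‖1 - s / t‖ : ℂ) ^ 2 := by
      rw [← Complex.normSq_eq_conj_mul_self, Complex.normSq_eq_norm_sq, norm_mul,
        norm_of_mem_psk (hr i), one_mul]
      push_cast
      rfl
    have h2 : (‖1 - s / t‖ : ℂ) ≠ 0 := by exact_mod_cast hωn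
    generalize r i * (1 - s / t) = u at h1 ⊢
    generalize ‖1 - s / t‖ = q at h1 h2 ⊢
    rw [map_div₀, map_mul, map_neg, Complex.conj_I, Complex.conj_ofReal, neg_neg]
    field_simp
    linear_combination h1

end Limit

/-! ### A pattern with positive limiting mass. -/

section Positivity

variable {N M : ℕ} {K : Matrix (Fin N) (Fin N) ℂ} {s : ℂ} {e : Fin N → ℂ} {δ : ℝ}

/-- For the neighbour pattern, `one_sub_conj_unitRoot` determines the directions: the noiseless
signal lies on the boundary between `s` and `s * conj (unitRoot M)`. -/
theorem eq_conj_bisector_of_directions (hM : 2 ≤ M) (hs : s ∈ psk M) (he : ∀ i, ‖e i‖ = 1)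
    (hδ : 0 < δ)
    (hu : ∀ i, conj (e i * s) * (s * (1 - s / (s * unitRoot M))) = δ * Complex.I) (i : Fin N) :
    e i = conj (bisector M) ∧ δ = 2 * Real.sin (Real.pi / M) := by
  have hs0 := ne_zero_of_mem_psk hs
  have hsin := sin_pi_div_pos hM
  have hω : s / (s * unitRoot M) = conj (unitRoot M) := by
    have h1 : ‖unitRoot M‖ = 1 := by rw [← bisector_sq, norm_mul, norm_bisector, one_mul]
    rw [← Complex.inv_eq_conj h1, div_mul_eq_div_div, div_self hs0, one_div]
  have hss : conj s * s = 1 := by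
    rw [← Complex.normSq_eq_conj_mul_self, Complex.normSq_eq_norm_sq, norm_of_mem_psk hs]
    simp
  have h := hu i
  rw [hω, one_sub_conj_unitRoot, map_mul] at h
  have h2 : conj (e i) * conj (bisector M) * (2 * (Real.sin (Real.pi / M) : ℂ)) = δ := by
    refine mul_right_cancel₀ Complex.I_ne_zero ?_
    rw [← h]
    linear_combination (-conj (e i) * conj (bisector M) * (2 * (Real.sin (Real.pi / M) : ℂ)) *
      Complex.I) * hss
  have hδ2 : δ = 2 * Real.sin (Real.pi / M) := by
    have h3 := congrArg norm h2
    rw [norm_mul, norm_mul, norm_mul, Complex.norm_conj, Complex.norm_conj, he, norm_bisector,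
      Complex.norm_real, Complex.norm_real, Real.norm_eq_abs, Real.norm_eq_abs, abs_of_pos hsin,
      abs_of_pos hδ] at h3
    simpa using h3.symm
  refine ⟨?_, hδ2⟩
  have hsC : (2 * (Real.sin (Real.pi / M) : ℂ)) ≠ 0 :=
    mul_ne_zero two_ne_zero (Complex.ofReal_ne_zero.2 hsin.ne')
  have h4 : conj (e i) * conj (bisector M) = 1 := by
    refine mul_right_cancel₀ hsC ?_
    rw [h2, hδ2]
    push_cast
    ring
  have h5 := congrArg conj h4
  rw [map_mul, Complex.conj_conj, Complex.conj_conj, map_one] at h5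
  have h6 : conj (bisector M) = (bisector M)⁻¹ := (Complex.inv_eq_conj (norm_bisector M)).symm
  rw [h6]
  exact eq_inv_of_mul_eq_one_left h5

/-- The leading coefficient is required to vanish as a function, not at `v`, so this alternative
does not depend on `v` and openness survives. -/
theorem isOpen_setOf_coeff_pos (t : ℂ) (r : Fin N → ℂ) :
    IsOpen {v | ∀ k : TestIndex M t r, 0 < leadCoeff s t r e k v ∨
      (leadCoeff s t r e k = 0 ∧ 0 < constCoeff s t r e k v)} := by
  have := finite_testIndex (M := M) t r
  simp only [Set.ofPred_forall]
  refine isOpen_iInter_of_finite fun k => ?_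
  refine (isOpen_lt continuous_const (continuous_leadCoeff k)).union ?_
  by_cases h : leadCoeff s t r e k = 0
  · simp only [h, true_and]
    exact isOpen_lt continuous_const (continuous_constCoeff k)
  · simp only [h, false_and]
    exact isOpen_empty

theorem limitMass_pos (hK : K.PosDef) (hM : 2 ≤ M) (hN : 0 < N) (hs : s ∈ psk M)
    (he : ∀ i, ‖e i‖ = 1) (hδ : 0 < δ)
    (hu : ∀ i, conj (e i * s) * (s * (1 - s / (s * unitRoot M))) = δ * Complex.I) :
    0 < limitMass M K s (s * unitRoot M) (fun _ => s) e := by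
  have hM0 : M ≠ 0 := by omega
  have hsin := sin_pi_div_pos hM
  have hs0 := ne_zero_of_mem_psk hs
  have hss : conj s * s = 1 := by
    rw [← Complex.normSq_eq_conj_mul_self, Complex.normSq_eq_norm_sq, norm_of_mem_psk hs]
    simp
  have hdir := eq_conj_bisector_of_directions hM hs he hδ hu
  have heb : e = fun _ => conj (bisector M) := funext fun i => (hdir i).1
  obtain ⟨σ, hσ⟩ : ∃ σ : ℝ, σ = Real.sin (Real.pi / M) := ⟨_, rfl⟩
  rw [← hσ] at hsin
  have hre : (2 * (σ : ℂ) * Complex.I).re = 0 := by simp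
  set U := {v | ∀ k : TestIndex M (s * unitRoot M) (fun _ : Fin N => s),
    0 < leadCoeff s (s * unitRoot M) (fun _ => s) e k v ∨
      (leadCoeff s (s * unitRoot M) (fun _ => s) e k = 0 ∧
        0 < constCoeff s (s * unitRoot M) (fun _ => s) e k v)} with hU
  have hUo : IsOpen U := isOpen_setOf_coeff_pos _ _
  have hbb := conj_bisector_mul_self M
  have hdiff : bisector M - conj (bisector M) =
      2 * (σ : ℂ) * Complex.I := by
    have h1 := one_sub_conj_unitRoot M
    rw [← hσ] at h1
    have h2 : conj (unitRoot M) = conj (bisector M) * conj (bisector M) := by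
      rw [← bisector_sq, map_mul]
    rw [h2] at h1
    linear_combination bisector M * h1 + (conj (bisector M) +
      2 * (σ : ℂ) * Complex.I) * hbb
  -- Transversal coordinate `-1` rotates the combined signal past the boundary from `s` towards `s *
  -- unitRoot M`, while noise of transversal size `2` brings every received entry back to the side
  -- of `s`.
  have hmem : ((fun _ => 1 - Complex.I, fun _ => 2 * s * conj (bisector M) * Complex.I) :
      (Fin N → ℂ) × (Fin N → ℂ)) ∈ U := by
    rintro (⟨⟨i, r'⟩, hr', hne⟩ | ⟨t', ht', hne⟩)
    · obtain ⟨ζ, rfl, hζ⟩ : ∃ ζ, r' = s * ζ ∧ ζ ^ M = 1 :=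
        ⟨r' / s, by field_simp, div_pow_eq_one_of_mem_psk hM0 hr' hs⟩
      have hlead : conj (e i * s) * (s - s * ζ) = conj (conj (bisector M) * (1 - conj ζ)) := by
        rw [heb]
        simp only [map_mul, map_sub, map_one, Complex.conj_conj]
        linear_combination bisector M * (1 - ζ) * hss
      have hζ1 : conj ζ ≠ 1 := by
        intro h
        apply hne
        have : ζ = 1 := by simpa using congrArg conj h
        simp [this]
      -- Only the competitor across the boundary has zero leading coefficient; there the noise
      -- decides. All others lose already at order `√ρ`.
      by_cases hζ2 : conj ζ = unitRoot M
      · have hζ3 : ζ = conj (unitRoot M) := by rw [← hζ2, Complex.conj_conj]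
        have hdiff2 : bisector M * (1 - ζ) = 2 * (σ : ℂ) * Complex.I := by
          rw [hζ3, one_sub_conj_unitRoot, ← hσ]
          linear_combination 2 * (σ : ℂ) * Complex.I * hbb
        have hl : conj (conj (bisector M) * (1 - conj ζ)) = bisector M * (1 - ζ) := by
          simp
        refine Or.inr ⟨?_, ?_⟩
        · funext v
          simp only [leadCoeff]
          rw [hlead, hl, hdiff2, hre, mul_zero]
          rfl
        · simp only [constCoeff]
          have h1 : conj (e i * (((1 - Complex.I).im : ℂ) * Complex.I) * s +
              2 * s * conj (bisector M) * Complex.I) * (s - s * ζ) =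
              ((2 * σ : ℝ) : ℂ) := by
            have h2 : conj (e i * (((1 - Complex.I).im : ℂ) * Complex.I) * s +
              2 * s * conj (bisector M) * Complex.I) * (s - s * ζ) =
              -Complex.I * (bisector M * (1 - ζ)) * (conj s * s) := by
              rw [heb]
              simp [Complex.conj_ofNat]
              ring
            rw [h2, hss, hdiff2]
            push_cast
            linear_combination -2 * (σ : ℂ) * Complex.I_mul_I
          rw [h1, Complex.ofReal_re]
          linarith
      · left
        simp only [leadCoeff]
        rw [hlead, Complex.conj_re]
        have h1 : (conj ζ) ^ M = 1 := by rw [← map_pow, hζ, map_one]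
        simpa using re_conj_bisector_mul_pos hM h1 hζ1 hζ2
    · obtain ⟨ζ, rfl, hζ⟩ : ∃ ζ, t' = s * ζ ∧ ζ ^ M = 1 :=
        ⟨t' / s, by field_simp, div_pow_eq_one_of_mem_psk hM0 ht' hs⟩
      have hne0 : Nonempty (Fin N) := ⟨⟨0, hN⟩⟩
      have hlead : ∀ i, e i * (conj s * (s * unitRoot M - s * ζ)) =
          2 * (σ : ℂ) * Complex.I + conj (bisector M) * (1 - ζ) := by
        intro i
        rw [heb, ← hdiff]
        linear_combination conj (bisector M) * (unitRoot M - ζ) * hss +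
          conj_bisector_mul_unitRoot M
      have hζ2 : ζ ≠ unitRoot M := fun h => hne (by rw [h])
      -- For the detector the balanced competitor is `s` itself, and the transversal coordinate
      -- decides.
      by_cases hζ1 : ζ = 1
      · refine Or.inr ⟨?_, ?_⟩
        · funext v
          simp only [leadCoeff]
          refine Finset.sum_eq_zero fun i _ => ?_
          rw [hlead, hζ1, sub_self, mul_zero, add_zero, hre, mul_zero]
        · simp only [constCoeff]
          refine Finset.sum_pos (fun i _ => ?_) Finset.univ_nonempty
          have h1 : e i * (((1 - Complex.I).im : ℂ) * Complex.I) *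
              (conj s * (s * unitRoot M - s * ζ)) = ((2 * σ : ℝ) : ℂ) := by
            have h2 : e i * (((1 - Complex.I).im : ℂ) * Complex.I) *
              (conj s * (s * unitRoot M - s * ζ)) =
              -Complex.I * (e i * (conj s * (s * unitRoot M - s * ζ))) := by
              simp
              ring
            rw [h2, hlead, hζ1]
            push_cast
            linear_combination -2 * (σ : ℂ) * Complex.I_mul_I
          rw [h1, Complex.ofReal_re]
          linarith
      · left
        simp only [leadCoeff]
        refine Finset.sum_pos (fun i _ => ?_) Finset.univ_nonempty
        rw [hlead, Complex.add_re, hre, zero_add, Complex.sub_re, Complex.I_re, Complex.one_re,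
          sub_zero, one_mul]
        exact re_conj_bisector_mul_pos hM hζ hζ1 hζ2
  have hq : Continuous fun v : (Fin N → ℂ) × (Fin N → ℂ) => jointDensity K (stretch e 0 v.1, v.2) :=
    (continuous_jointDensity K).comp
      (((continuous_stretch e 0).comp continuous_fst).prodMk continuous_snd)
  have hpos : 0 < ∫⁻ v in U, ENNReal.ofReal (jointDensity K (stretch e 0 v.1, v.2)) := by
    rw [setLIntegral_pos_iff hq.measurable.ennreal_ofReal]
    have hsupp : (Function.support fun v : (Fin N → ℂ) × (Fin N → ℂ) =>
        ENNReal.ofReal (jointDensity K (stretch e 0 v.1, v.2))) = Set.univ := by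
      refine Set.eq_univ_of_forall fun v => ?_
      exact (ENNReal.ofReal_pos.2 (jointDensity_pos hK _)).ne'
    rw [hsupp, Set.univ_inter]
    exact hUo.measure_pos volume ⟨_, hmem⟩
  refine hpos.trans_le ?_
  rw [← lintegral_indicator hUo.measurableSet]
  refine lintegral_mono fun v => Set.indicator_le_indicator_of_subset ?_ (fun _ => zero_le) v
  intro v hv k
  exact eventually_pos_of_tendsto ((hv k).imp_right fun h => ⟨congrFun h.1 v, h.2⟩)
    (tendsto_decisionTest_sub hK he k v)

end Positivity

/-! ### Assembling the error probability from the patterns. -/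

section ErrorProbability

variable {N M : ℕ}

/-- The triples of a transmitted symbol, quantizer outputs and a wrong detected symbol. -/
def errorPatterns (M N : ℕ) : Finset (ℂ × (Fin N → ℂ) × ℂ) :=
  open scoped Classical in
  ((finite_psk M).toFinset ×ˢ (Fintype.piFinset fun _ => (finite_psk M).toFinset) ×ˢ
    (finite_psk M).toFinset).filter fun j => j.2.2 ≠ j.1

theorem mem_errorPatterns {j : ℂ × (Fin N → ℂ) × ℂ} :
    j ∈ errorPatterns M N ↔ j.1 ∈ psk M ∧ (∀ i, j.2.1 i ∈ psk M) ∧ j.2.2 ∈ psk M ∧ j.2.2 ≠ j.1 := by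
  simp [errorPatterns, Fintype.mem_piFinset, and_assoc]

/-- All tests of the pattern `j` are passed, possibly with ties. -/
def weakRegion (M : ℕ) (K : Matrix (Fin N) (Fin N) ℂ) (ρ : ℝ) (j : ℂ × (Fin N → ℂ) × ℂ) :
    Set ((Fin N → ℂ) × (Fin N → ℂ)) :=
  {v | ∀ k : TestIndex M j.2.2 j.2.1, 0 ≤ decisionTest K j.1 j.2.2 j.2.1 k ρ v}

/-- All tests of the pattern `j` are passed without ties. -/
def strictRegion (M : ℕ) (K : Matrix (Fin N) (Fin N) ℂ) (ρ : ℝ) (j : ℂ × (Fin N → ℂ) × ℂ) :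
    Set ((Fin N → ℂ) × (Fin N → ℂ)) :=
  {v | ∀ k : TestIndex M j.2.2 j.2.1, 0 < decisionTest K j.1 j.2.2 j.2.1 k ρ v}

theorem measurableSet_weakRegion (K : Matrix (Fin N) (Fin N) ℂ) (ρ : ℝ)
    (j : ℂ × (Fin N → ℂ) × ℂ) : MeasurableSet (weakRegion M K ρ j) := by
  have := finite_testIndex (M := M) j.2.2 j.2.1
  simp only [weakRegion, Set.ofPred_forall]
  exact MeasurableSet.iInter fun k =>
    measurableSet_le measurable_const (continuous_decisionTest k ρ).measurable

theorem measurableSet_strictRegion (K : Matrix (Fin N) (Fin N) ℂ) (ρ : ℝ)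
    (j : ℂ × (Fin N → ℂ) × ℂ) : MeasurableSet (strictRegion M K ρ j) := by
  have := finite_testIndex (M := M) j.2.2 j.2.1
  simp only [strictRegion, Set.ofPred_forall]
  exact MeasurableSet.iInter fun k =>
    measurableSet_lt measurable_const (continuous_decisionTest k ρ).measurable

theorem strictRegion_subset_weakRegion (K : Matrix (Fin N) (Fin N) ℂ) (ρ : ℝ)
    (j : ℂ × (Fin N → ℂ) × ℂ) : strictRegion M K ρ j ⊆ weakRegion M K ρ j :=
  fun _ hv k => (hv k).le

variable {Q D : ℂ → ℂ}

theorem mem_weakRegion (hQ : IsNearestPoint M Q) (hD : IsNearestPoint M D)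
    (K : Matrix (Fin N) (Fin N) ℂ) (ρ : ℝ) (x w : Fin N → ℂ) (s : ℂ) :
    (x, w) ∈ weakRegion M K ρ
      (s, fun i => Q (received ρ x s w i), amrcEstimate Q D K ρ x s w) := by
  rintro (k | k)
  · exact hQ.nonneg _ k.2.1
  · exact hD.nonneg _ k.2.1

theorem eq_of_mem_strictRegion (hQ : IsNearestPoint M Q) (hD : IsNearestPoint M D)
    {K : Matrix (Fin N) (Fin N) ℂ} {ρ : ℝ} {x w : Fin N → ℂ} {j : ℂ × (Fin N → ℂ) × ℂ}
    (hj : j ∈ errorPatterns M N) (h : (x, w) ∈ strictRegion M K ρ j) :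
    (fun i => Q (received ρ x j.1 w i)) = j.2.1 ∧ amrcEstimate Q D K ρ x j.1 w = j.2.2 := by
  obtain ⟨-, hr, ht, -⟩ := mem_errorPatterns.1 hj
  have h1 : (fun i => Q (received ρ x j.1 w i)) = j.2.1 := by
    funext i
    exact hQ.eq_of_forall_pos (hr i) fun b hb hne => h (.inl ⟨(i, b), hb, hne⟩)
  refine ⟨h1, ?_⟩
  rw [amrcEstimate, h1]
  exact hD.eq_of_forall_pos ht fun b hb hne => h (.inr ⟨b, hb, hne⟩)

variable {Ω : Type*} [MeasurableSpace Ω] {μ : Measure Ω}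
  {K : Matrix (Fin N) (Fin N) ℂ} {h w : Ω → Fin N → ℂ} {s : Ω → ℂ}

theorem measure_symbol_notMem (hs : HasLaw s (uniformOn (psk M)) μ) :
    μ {ω | s ω ∉ psk M} = 0 := by
  have hm : MeasurableSet (psk M)ᶜ := (finite_psk M).measurableSet.compl
  change μ (s ⁻¹' (psk M)ᶜ) = 0
  rw [← Measure.map_apply_of_aemeasurable hs.aemeasurable hm, hs.map_eq, uniformOn,
    cond_apply (finite_psk M).measurableSet]
  simp

theorem measure_symbol_pos (hs : HasLaw s (uniformOn (psk M)) μ) {a : ℂ} (ha : a ∈ psk M) :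
    0 < μ (s ⁻¹' {a}) := by
  rw [← Measure.map_apply_of_aemeasurable hs.aemeasurable (measurableSet_singleton a), hs.map_eq,
    uniformOn, cond_apply (finite_psk M).measurableSet]
  refine ENNReal.mul_pos (ENNReal.inv_ne_zero.2 ?_) ?_
  · rw [Measure.count_apply_finite _ (finite_psk M)]
    exact ENNReal.natCast_ne_top _
  · rw [Set.inter_eq_self_of_subset_right (Set.singleton_subset_iff.2 ha),
      Measure.count_singleton]
    exact one_ne_zero

variable [IsProbabilityMeasure μ]

theorem measure_symbol_inter (hh : HasLaw h (complexGaussian K) μ)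
    (hw : HasLaw w (complexGaussian 1) μ) (hind : IndepFun h w μ)
    (hinds : IndepFun s (fun ω => (h ω, w ω)) μ) (a : ℂ)
    {S : Set ((Fin N → ℂ) × (Fin N → ℂ))} (hS : MeasurableSet S) :
    μ (s ⁻¹' {a} ∩ (fun ω => (h ω, w ω)) ⁻¹' S) = μ (s ⁻¹' {a}) * jointLaw K S := by
  rw [hinds.measure_inter_preimage_eq_mul _ _ (measurableSet_singleton a) hS,
    ← Measure.map_apply_of_aemeasurable (hh.aemeasurable.prodMk hw.aemeasurable) hS,
    (indepFun_iff_map_prod_eq_prod_map_map hh.aemeasurable hw.aemeasurable).1 hind, hh.map_eq,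
    hw.map_eq, jointLaw]

/-- `Q` and `D` need not be measurable, so the error event is only enclosed between measurable
regions; monotonicity of the outer measure suffices. -/
theorem measure_error_le (hQ : IsNearestPoint M Q) (hD : IsNearestPoint M D)
    (hh : HasLaw h (complexGaussian K) μ) (hw : HasLaw w (complexGaussian 1) μ)
    (hs : HasLaw s (uniformOn (psk M)) μ) (hind : IndepFun h w μ)
    (hinds : IndepFun s (fun ω => (h ω, w ω)) μ) (ρ : ℝ) :
    μ {ω | amrcEstimate Q D K ρ (h ω) (s ω) (w ω) ≠ s ω} ≤
      ∑ j ∈ errorPatterns M N, μ (s ⁻¹' {j.1}) * jointLaw K (weakRegion M K ρ j) := by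
  have hsub : {ω | amrcEstimate Q D K ρ (h ω) (s ω) (w ω) ≠ s ω} ⊆ {ω | s ω ∉ psk M} ∪
      ⋃ j ∈ errorPatterns M N,
        s ⁻¹' {j.1} ∩ (fun ω => (h ω, w ω)) ⁻¹' weakRegion M K ρ j := by
    intro ω hω
    by_cases hsω : s ω ∈ psk M
    · refine Or.inr (Set.mem_iUnion₂.2 ⟨(s ω, fun i => Q (received ρ (h ω) (s ω) (w ω) i),
        amrcEstimate Q D K ρ (h ω) (s ω) (w ω)), ?_, rfl, ?_⟩)
      · exact mem_errorPatterns.2 ⟨hsω, fun i => (hQ _).1, (hD _).1, hω⟩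
      · exact mem_weakRegion hQ hD K ρ _ _ _
    · exact Or.inl hsω
  refine (measure_mono hsub).trans ((measure_union_le _ _).trans ?_)
  rw [measure_symbol_notMem hs, zero_add]
  refine (measure_biUnion_finset_le _ _).trans (Finset.sum_le_sum fun j _ => ?_)
  rw [measure_symbol_inter hh hw hind hinds _ (measurableSet_weakRegion K ρ j)]

/-- Without ties the tests determine the outputs and the decision, so strict regions of different
patterns give disjoint events and their probabilities add. -/
theorem le_measure_error (hQ : IsNearestPoint M Q) (hD : IsNearestPoint M D)
    (hh : HasLaw h (complexGaussian K) μ) (hw : HasLaw w (complexGaussian 1) μ)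
    (hs : HasLaw s (uniformOn (psk M)) μ) (hind : IndepFun h w μ)
    (hinds : IndepFun s (fun ω => (h ω, w ω)) μ) (ρ : ℝ) :
    ∑ j ∈ errorPatterns M N, μ (s ⁻¹' {j.1}) * jointLaw K (strictRegion M K ρ j) ≤
      μ {ω | amrcEstimate Q D K ρ (h ω) (s ω) (w ω) ≠ s ω} := by
  set E : ℂ × (Fin N → ℂ) × ℂ → Set Ω := fun j =>
    s ⁻¹' {j.1} ∩ (fun ω => (h ω, w ω)) ⁻¹' strictRegion M K ρ j with hE
  have hmem : ∀ j ∈ errorPatterns M N, ∀ ω ∈ E j,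
      s ω = j.1 ∧ (fun i => Q (received ρ (h ω) (s ω) (w ω) i)) = j.2.1 ∧
        amrcEstimate Q D K ρ (h ω) (s ω) (w ω) = j.2.2 := by
    rintro j hj ω ⟨h1, h2⟩
    have h3 : s ω = j.1 := h1
    rw [h3]
    exact ⟨rfl, eq_of_mem_strictRegion hQ hD hj h2⟩
  have hnull : ∀ j ∈ errorPatterns M N, NullMeasurableSet (E j) μ := fun j _ =>
    (hs.aemeasurable.nullMeasurableSet_preimage (measurableSet_singleton _)).inter
      ((hh.aemeasurable.prodMk hw.aemeasurable).nullMeasurableSet_preimage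
        (measurableSet_strictRegion K ρ j))
  have hdisj : ((errorPatterns M N : Finset _) : Set (ℂ × (Fin N → ℂ) × ℂ)).Pairwise
      (Function.onFun (AEDisjoint μ) E) := by
    intro j hj j' hj' hne
    refine (Set.disjoint_left.2 fun ω h1 h2 => hne ?_).aedisjoint
    obtain ⟨a1, a2, a3⟩ := hmem j hj ω h1
    obtain ⟨b1, b2, b3⟩ := hmem j' hj' ω h2
    exact Prod.ext (a1.symm.trans b1) (Prod.ext (a2.symm.trans b2) (a3.symm.trans b3))
  calc ∑ j ∈ errorPatterns M N, μ (s ⁻¹' {j.1}) * jointLaw K (strictRegion M K ρ j)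
      = ∑ j ∈ errorPatterns M N, μ (E j) := Finset.sum_congr rfl fun j _ =>
        (measure_symbol_inter hh hw hind hinds _ (measurableSet_strictRegion K ρ j)).symm
    _ = μ (⋃ j ∈ errorPatterns M N, E j) := (measure_biUnion_finset₀ hdisj hnull).symm
    _ ≤ _ := by
        refine measure_mono (Set.iUnion₂_subset fun j hj ω hω => ?_)
        obtain ⟨a1, -, a3⟩ := hmem j hj ω hω
        change amrcEstimate Q D K ρ (h ω) (s ω) (w ω) ≠ s ω
        rw [a3, a1]
        exact (mem_errorPatterns.1 hj).2.2.2

theorem exists_tendsto_sqrt_pow_mul_sep (hN : 0 < N) (hM : 2 ≤ M) (hK : K.PosDef)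
    (hQ : IsNearestPoint M Q) (hD : IsNearestPoint M D)
    (hh : HasLaw h (complexGaussian K) μ) (hw : HasLaw w (complexGaussian 1) μ)
    (hs : HasLaw s (uniformOn (psk M)) μ) (hind : IndepFun h w μ)
    (hinds : IndepFun s (fun ω => (h ω, w ω)) μ) :
    ∃ l : ℝ, 0 < l ∧ Tendsto (fun ρ => √ρ ^ N * sep μ Q D K h s w ρ) atTop (𝓝 l) := by
  have hM0 : M ≠ 0 := by omega
  have hdir : ∀ j : ℂ × (Fin N → ℂ) × ℂ, ∃ e : Fin N → ℂ, j ∈ errorPatterns M N →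
      ∃ δ : ℝ, (∀ i, ‖e i‖ = 1) ∧ 0 < δ ∧
        ∀ i, conj (e i * j.1) * (j.2.1 i * (1 - j.1 / j.2.2)) = δ * Complex.I := by
    intro j
    by_cases hj : j ∈ errorPatterns M N
    · obtain ⟨h1, h2, h3, h4⟩ := mem_errorPatterns.1 hj
      obtain ⟨e, δ, h5⟩ := exists_unit_directions h1 h3 h4 h2
      exact ⟨e, fun _ => ⟨δ, h5⟩⟩
    · exact ⟨0, fun h => absurd h hj⟩
  choose e he using hdir
  set L : ℝ≥0∞ := ∑ j ∈ errorPatterns M N,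
    μ (s ⁻¹' {j.1}) * limitMass M K j.1 j.2.2 j.2.1 (e j) with hL
  have hlim : ∀ j ∈ errorPatterns M N, ∀ S : ℝ → Set ((Fin N → ℂ) × (Fin N → ℂ)),
      (∀ ρ, MeasurableSet (S ρ)) → (∀ ρ, strictRegion M K ρ j ⊆ S ρ) →
      (∀ ρ, S ρ ⊆ weakRegion M K ρ j) →
      Tendsto (fun ρ => ENNReal.ofReal (√ρ ^ N) * jointLaw K (S ρ)) atTop
        (𝓝 (limitMass M K j.1 j.2.2 j.2.1 (e j))) ∧
      limitMass M K j.1 j.2.2 j.2.1 (e j) ≠ ∞ := by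
    intro j hj S h1 h2 h3
    obtain ⟨a1, a2, a3, a4⟩ := mem_errorPatterns.1 hj
    obtain ⟨δ, b1, b2, b3⟩ := he j hj
    exact tendsto_jointLaw hK hM0 hN a1 a3 a4 a2 b1 b2 b3 h1 h2 h3
  have hLtop : L ≠ ∞ := by
    refine ENNReal.sum_ne_top.2 fun j hj => ENNReal.mul_ne_top (measure_ne_top _ _) ?_
    exact (hlim j hj (fun ρ => weakRegion M K ρ j) (fun ρ => measurableSet_weakRegion K ρ j)
      (fun ρ => strictRegion_subset_weakRegion K ρ j) fun ρ => subset_rfl).2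
  have hLpos : 0 < L := by
    obtain ⟨a, ha⟩ := nonempty_psk hM0
    have ha0 := ne_zero_of_mem_psk ha
    have hj : (a, (fun _ : Fin N => a), a * unitRoot M) ∈ errorPatterns M N := by
      refine mem_errorPatterns.2 ⟨ha, fun _ => ha,
        mul_mem_psk_of_pow_eq_one hM0 ha (unitRoot_pow hM0), fun h => ?_⟩
      have h1 : unitRoot M = 1 := by simpa [ha0] using h
      exact (Complex.isPrimitiveRoot_exp M hM0).ne_one (by omega) h1
    obtain ⟨δ, b1, b2, b3⟩ := he _ hj
    have h1 := limitMass_pos hK hM hN ha b1 b2 b3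
    exact (ENNReal.mul_pos (measure_symbol_pos hs ha).ne' h1.ne').trans_le
      (Finset.single_le_sum (f := fun j => μ (s ⁻¹' {j.1}) * limitMass M K j.1 j.2.2 j.2.1 (e j))
        (fun _ _ => zero_le) hj)
  have hsum : ∀ S : ℝ → ℂ × (Fin N → ℂ) × ℂ → Set ((Fin N → ℂ) × (Fin N → ℂ)),
      (∀ ρ j, MeasurableSet (S ρ j)) → (∀ ρ j, strictRegion M K ρ j ⊆ S ρ j) →
      (∀ ρ j, S ρ j ⊆ weakRegion M K ρ j) →
      Tendsto (fun ρ => ENNReal.ofReal (√ρ ^ N) *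
        ∑ j ∈ errorPatterns M N, μ (s ⁻¹' {j.1}) * jointLaw K (S ρ j)) atTop (𝓝 L) := by
    intro S h1 h2 h3
    have h4 : Tendsto (fun ρ => ∑ j ∈ errorPatterns M N,
        μ (s ⁻¹' {j.1}) * (ENNReal.ofReal (√ρ ^ N) * jointLaw K (S ρ j))) atTop (𝓝 L) :=
      tendsto_finsetSum _ fun j hj => ENNReal.Tendsto.const_mul
        (hlim j hj (fun ρ => S ρ j) (fun ρ => h1 ρ j) (fun ρ => h2 ρ j) fun ρ => h3 ρ j).1
        (Or.inr (measure_ne_top _ _))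
    refine h4.congr fun ρ => ?_
    rw [Finset.mul_sum]
    exact Finset.sum_congr rfl fun j _ => mul_left_comm _ _ _
  -- Squeeze between the strict and the weak sums, which share the limit `L`.
  have hE : Tendsto (fun ρ => ENNReal.ofReal (√ρ ^ N) *
      μ {ω | amrcEstimate Q D K ρ (h ω) (s ω) (w ω) ≠ s ω}) atTop (𝓝 L) :=
    tendsto_of_tendsto_of_tendsto_of_le_of_le
      (hsum (strictRegion M K) (measurableSet_strictRegion K) (fun _ _ => subset_rfl)
        (strictRegion_subset_weakRegion K))
      (hsum (weakRegion M K) (measurableSet_weakRegion K) (strictRegion_subset_weakRegion K)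
        fun _ _ => subset_rfl)
      (fun ρ => mul_le_mul_right (le_measure_error hQ hD hh hw hs hind hinds ρ) _)
      (fun ρ => mul_le_mul_right (measure_error_le hQ hD hh hw hs hind hinds ρ) _)
  refine ⟨L.toReal, ENNReal.toReal_pos hLpos.ne' hLtop, ?_⟩
  refine ((ENNReal.tendsto_toReal hLtop).comp hE).congr fun ρ => ?_
  rw [Function.comp_apply, ENNReal.toReal_mul,
    ENNReal.toReal_ofReal (pow_nonneg (Real.sqrt_nonneg ρ) N)]
  rfl

theorem hasDiversityGain_of_tendsto {P : ℝ → ℝ} {N : ℕ} (hN : 0 < N) {l : ℝ} (hl : 0 < l)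
    (h : Tendsto (fun ρ => √ρ ^ N * P ρ) atTop (𝓝 l)) : HasDiversityGain P ((N : ℝ) / 2) := by
  have hN0 : (N : ℝ) ≠ 0 := Nat.cast_ne_zero.2 hN.ne'
  -- The coding gain solves `Gc ^ (-N/2) = l`.
  refine ⟨l ^ (-(2 / (N : ℝ))), Real.rpow_pos_of_pos hl _, ?_⟩
  have hval : ∀ ρ : ℝ, 0 < ρ →
      (l ^ (-(2 / (N : ℝ))) * ρ) ^ (-((N : ℝ) / 2)) = l * (√ρ ^ N)⁻¹ := by
    intro ρ hρ
    rw [Real.mul_rpow (Real.rpow_nonneg hl.le _) hρ.le, ← Real.rpow_mul hl.le,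
      Real.rpow_neg hρ.le, Real.sqrt_eq_rpow, ← Real.rpow_natCast, ← Real.rpow_mul hρ.le]
    have h1 : -(2 / (N : ℝ)) * -((N : ℝ) / 2) = 1 := by field_simp
    have h2 : 1 / 2 * (N : ℝ) = N / 2 := by ring
    rw [h1, h2, Real.rpow_one]
  rw [Asymptotics.isEquivalent_iff_tendsto_one]
  · have h1 := h.div_const l
    rw [div_self hl.ne'] at h1
    refine h1.congr' ?_
    filter_upwards [eventually_gt_atTop 0] with ρ hρ
    have := pow_pos (Real.sqrt_pos.2 hρ) N
    rw [Pi.div_apply, hval ρ hρ]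
    field_simp
  · filter_upwards [eventually_gt_atTop 0] with ρ hρ
    rw [hval ρ hρ]
    have := pow_pos (Real.sqrt_pos.2 hρ) N
    positivity

end ErrorProbability

end PhaseQuantizedSIMO

end

theorem proposition4
    {Ω : Type*} [MeasurableSpace Ω] (μ : MeasureTheory.Measure Ω)
    [MeasureTheory.IsProbabilityMeasure μ]
    (Nr M n : ℕ) (hNr : 1 ≤ Nr) (hn : 1 ≤ n) (hM : M = 2 ^ n)
    -- the full-rank channel covariance matrix
    (K : Matrix (Fin Nr) (Fin Nr) ℂ) (hK : K.PosDef)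
    -- the `n`-bit phase quantizer and the `M`-PSK minimum-distance detector
    (Q D : ℂ → ℂ) (hQ : PhaseQuantizedSIMO.IsNearestPoint (2 ^ n) Q)
    (hD : PhaseQuantizedSIMO.IsNearestPoint M D)
    -- the channel, the noise and the transmitted symbol, mutually independent
    (h w : Ω → Fin Nr → ℂ) (s : Ω → ℂ)
    (hh : ProbabilityTheory.HasLaw h (PhaseQuantizedSIMO.complexGaussian K) μ)
    (hw : ProbabilityTheory.HasLaw w (PhaseQuantizedSIMO.complexGaussian 1) μ)
    (hs : ProbabilityTheory.HasLaw s
      (ProbabilityTheory.uniformOn (PhaseQuantizedSIMO.psk M)) μ)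
    (hind : ProbabilityTheory.IndepFun h w μ)
    (hinds : ProbabilityTheory.IndepFun s (fun ω => (h ω, w ω)) μ) :
    PhaseQuantizedSIMO.HasDiversityGain
      (PhaseQuantizedSIMO.sep μ Q D K h s w) ((Nr : ℝ) / 2) := by
  subst hM
  have hM2 : 2 ≤ 2 ^ n := by
    calc 2 = 2 ^ 1 := (pow_one 2).symm
      _ ≤ 2 ^ n := Nat.pow_le_pow_right two_pos hn
  obtain ⟨l, hl, hlim⟩ := PhaseQuantizedSIMO.exists_tendsto_sqrt_pow_mul_sep
    hNr hM2 hK hQ hD hh hw hs hind hinds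
  exact PhaseQuantizedSIMO.hasDiversityGain_of_tendsto hNr hl hlim
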